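/- Let $W(3,2,2)$ be a smooth three-web on a four-dimensional manifold $X^4$, i.e. three foliations $\lambda_1,\lambda_2,\lambda_3$ of codimension two, pairwise transversal. Take a smooth family of adapted coframes of the web (for example one moving coframe, or a bundle of specialized coframes), with basis forms $\underset{\alpha}{\omega}^i$ ($\alpha,i=1,2$) such that the foliations $\lambda_\xi$ are given by $\underset{\xi}{\omega}^1=\underset{\xi}{\omega}^2=0$, where $\underset{3}{\omega}^i=-\underset{1}{\omega}^i-\underset{2}{\omega}^i$. Let $\omega^i_j$ be the connection forms and $a=(a_1,a_2)$ the covector of the web in this family, that is, the forms and functions determined by the structure equations $$d\underset{1}{\omega}^i=\underset{1}{\omega}^j\wedge\omega^i_j+a_j\,\underset{1}{\omega}^j\wedge\underset{1}{\omega}^i,\qquad d\underset{2}{\omega}^i=\underset{2}{\omega}^j\wedge\omega^i_j-a_j\,\underset{2}{\omega}^j\wedge\underset{2}{\omega}^i ,$$ let $p_{ij},q_{ij}$ be the Pfaffian derivatives defined by $da_i-a_j\omega^j_i=p_{ij}\underset{1}{\omega}^j+q_{ij}\underset{2}{\omega}^j$, put $p_{(12)}=\frac12(p_{12}+p_{21})$,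 $q_{(12)}=\frac12(q_{12}+q_{21})$, and let $\pi^j_i$ be the restriction of $\omega^j_i$ to the vectors annihilated by all $\underset{\alpha}{\omega}^k$. Assume that $a\neq 0$ everywhere, and let $\Delta$ be the transversal $a$-distribution on $X^4$, given by $a_1\underset{\alpha}{\omega}^1+a_2\underset{\alpha}{\omega}^2=0$, $\alpha=1,2$. 1. If $a_2=0$ and $\pi^1_2=0$, then $\Delta$ coincides with the distribution $\underset{\alpha}{\omega}^1=0$ $(\alpha=1,2)$, and $\Delta$ is integrable if and only if $p_{22}=q_{22}=0$. 2. If $a_1=0$ and $\pi^2_1=0$, then $\Delta$ coincides with the distribution $\underset{\alpha}{\omega}^2=0$ $(\alpha=1,2)$, and $\Delta$ is integrable if and only if $p_{11}=q_{11}=0$. 3. If $a_1=a_2$ and $\pi^1_1+\pi^2_1-\pi^1_2-\pi^2_2=0$, then $\Delta$ coincides with the distribution $\underset{\alpha}{\omega}^1+\underset{\alpha}{\omega}^2=0$ $(\alpha=1,2)$, and $\Delta$ is integrable if and only if $p_{11}-2p_{(12)}+p_{22}=0$ and $q_{11}-2q_{(12)}+q_{22}=0$. Here $\Delta$ is integrable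 if an integral surface of $\Delta$ passes through every point of $X^4$, and all identities between forms and functions are required to hold everywhere. -/

import Mathlib

open scoped Manifold ContDiff

noncomputable section

/-! ### Differential one-forms on a smooth manifold without boundary -/

/-- A (not necessarily smooth) one-form on an `N`-dimensional manifold. -/
abbrev OneForm (N : ℕ) (M : Type*) [TopologicalSpace M]
    [ChartedSpace (EuclideanSpace ℝ (Fin N)) M] : Type _ :=
  (x : M) → TangentSpace (𝓡 N) x →L[ℝ] ℝ

namespace OneForm

variable {N : ℕ} {M : Type*} [TopologicalSpace M] [ChartedSpace (EuclideanSpace ℝ (Fin N)) M]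

/-- The expression of a one-form in the preferred chart at `x`: its pullback under the inverse of
the chart, meaningful on the target of the chart. -/
def inChart (η : OneForm N M) (x : M) (y : EuclideanSpace ℝ (Fin N)) :
    EuclideanSpace ℝ (Fin N) →L[ℝ] ℝ :=
  (η ((extChartAt (𝓡 N) x).symm y)).comp
    (mfderiv 𝓘(ℝ, EuclideanSpace ℝ (Fin N)) (𝓡 N) (extChartAt (𝓡 N) x).symm y)

/-- A one-form is smooth if all its chart expressions are. -/
def IsSmooth (η : OneForm N M) : Prop :=
  ∀ x : M, ContDiffOn ℝ ∞ (η.inChart x) (extChartAt (𝓡 N) x).target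

/-- The exterior derivative `dη` at `x`, evaluated on two tangent vectors `u` and `v`, computed in
the preferred chart at `x`; thus `dη(u, v) = u(η(v)) - v(η(u))` for constant `u`, `v` in the
chart. -/
def d (η : OneForm N M) (x : M) (u v : TangentSpace (𝓡 N) x) : ℝ :=
  extDeriv (fun y => ContinuousAlternatingMap.ofSubsingleton ℝ (EuclideanSpace ℝ (Fin N)) ℝ
      (0 : Fin 1) (η.inChart x y))
    (extChartAt (𝓡 N) x x)
    ![mfderiv (𝓡 N) 𝓘(ℝ, EuclideanSpace ℝ (Fin N)) (extChartAt (𝓡 N) x) x u,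
      mfderiv (𝓡 N) 𝓘(ℝ, EuclideanSpace ℝ (Fin N)) (extChartAt (𝓡 N) x) x v]

/-- The differential `df` of a function, as a one-form. -/
def differential (f : M → ℝ) : OneForm N M :=
  fun x => mfderiv (𝓡 N) 𝓘(ℝ, ℝ) f x

/-- The exterior product of two one-forms at `x`, evaluated on `u` and `v`. -/
def wedge (η ζ : OneForm N M) (x : M) (u v : TangentSpace (𝓡 N) x) : ℝ :=
  η x u * ζ x v - η x v * ζ x u

end OneForm

/-! ### Distributions, foliations and three-webs `W(3, 2, 2)` -/

section Web

variable (X : Type*) [TopologicalSpace X] [ChartedSpace (EuclideanSpace ℝ (Fin 4)) X]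

/-- A field of tangent subspaces on a four-dimensional manifold. -/
abbrev TangentDistribution : Type _ :=
  (x : X) → Submodule ℝ (TangentSpace (𝓡 4) x)

variable {X}

/-- A field `D` of tangent subspaces is the tangent field of a foliation of codimension two if it is
locally the field of kernels of the differential of a smooth submersion to the plane (whose level
sets are the local leaves). -/
def IsFoliationCodimTwo (D : TangentDistribution X) : Prop :=
  ∀ x : X, ∃ (U : Set X) (f : X → EuclideanSpace ℝ (Fin 2)), IsOpen U ∧ x ∈ U ∧
    ContMDiffOn (𝓡 4) (𝓡 2) ∞ f U ∧
    ∀ y ∈ U, Function.Surjective (mfderiv (𝓡 4) (𝓡 2) f y) ∧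
      D y = LinearMap.ker (mfderiv (𝓡 4) (𝓡 2) f y).toLinearMap

/-- A two-dimensional distribution `D` is integrable if through every point there passes an integral
surface of `D`, that is, a smooth immersed surface tangent to `D` at each of its points. -/
def IsIntegrable (D : TangentDistribution X) : Prop :=
  ∀ x : X, ∃ (U : Set (EuclideanSpace ℝ (Fin 2))) (φ : EuclideanSpace ℝ (Fin 2) → X),
    IsOpen U ∧ (0 : EuclideanSpace ℝ (Fin 2)) ∈ U ∧ φ 0 = x ∧
    ContMDiffOn (𝓡 2) (𝓡 4) ∞ φ U ∧
    ∀ y ∈ U, Function.Injective (mfderiv (𝓡 2) (𝓡 4) φ y) ∧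
      LinearMap.range (mfderiv (𝓡 2) (𝓡 4) φ y).toLinearMap = D (φ y)

variable (X) in
/-- A three-web `W(3, 2, 2)`: three foliations of codimension two in general position on a
four-dimensional manifold, given by the tangent planes of their leaves. -/
structure ThreeWeb where
  /-- The tangent plane at a point of the leaf of the `ξ`-th foliation. -/
  tangent : Fin 3 → TangentDistribution X
  isFoliation : ∀ ξ, IsFoliationCodimTwo (tangent ξ)
  transversal : ∀ ξ η, ξ ≠ η → ∀ x, tangent ξ x ⊓ tangent η x = ⊥

/-- A smooth family of adapted coframes of a three-web, parametrized by a manifold `P`: a single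
moving coframe (`P = X`), the bundle of all adapted coframes, or a subbundle of specialized ones.
Over each `p : P` there is a point `proj p` of the web together with covectors
`θ α i p` (`α`, `i` in `{1, 2}`, written `{0, 1}`) such that, with `θ₃ = -(θ₁ + θ₂)`, the tangent
plane of the `ξ`-th foliation is given by `θ_ξ¹ = θ_ξ² = 0`. -/
structure AdaptedCoframes (W : ThreeWeb X) (N : ℕ) (P : Type*) [TopologicalSpace P]
    [ChartedSpace (EuclideanSpace ℝ (Fin N)) P] where
  /-- The base point of a coframe. -/
  proj : P → X
  surjective : Function.Surjective proj
  isSubmersion : Manifold.IsSubmersion (𝓡 N) (𝓡 4) ∞ proj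
  /-- The covectors of the coframe. -/
  θ : Fin 2 → Fin 2 → (p : P) → TangentSpace (𝓡 4) (proj p) →L[ℝ] ℝ
  adapted_one : ∀ p, W.tangent 0 (proj p) = ⨅ i, LinearMap.ker (θ 0 i p).toLinearMap
  adapted_two : ∀ p, W.tangent 1 (proj p) = ⨅ i, LinearMap.ker (θ 1 i p).toLinearMap
  adapted_three : ∀ p,
    W.tangent 2 (proj p) = ⨅ i, LinearMap.ker (-(θ 0 i p + θ 1 i p)).toLinearMap
  smooth : ∀ α i, OneForm.IsSmooth (N := N) (M := P)
    fun p => (θ α i p).comp (mfderiv (𝓡 N) (𝓡 4) proj p)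

namespace AdaptedCoframes

variable {W : ThreeWeb X} {N : ℕ} {P : Type*} [TopologicalSpace P]
  [ChartedSpace (EuclideanSpace ℝ (Fin N)) P] (F : AdaptedCoframes W N P)

/-- The basis forms `ω_α^i` of the web on the parameter manifold `P` of the family. -/
def basisForm (α i : Fin 2) : OneForm N P :=
  fun p => (F.θ α i p).comp (mfderiv (𝓡 N) (𝓡 4) F.proj p)

/-- `conn j i = ω_j^i` are the connection forms and `a j = a_j` the components of the (torsion)
covector of the web, relative to the family of coframes: the smooth forms and functions in the
structure equations
`dω₁^i = ω₁^j ∧ ω_j^i + a_j ω₁^j ∧ ω₁^i`, `dω₂^i = ω₂^j ∧ ω_j^i - a_j ω₂^j ∧ ω₂^i`.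
These equations determine them uniquely. -/
def IsConnection (conn : Fin 2 → Fin 2 → OneForm N P) (a : Fin 2 → P → ℝ) : Prop :=
  (∀ j i, (conn j i).IsSmooth) ∧
  (∀ j, ContMDiff (𝓡 N) 𝓘(ℝ, ℝ) ∞ (a j)) ∧
  (∀ i p u v, (F.basisForm 0 i).d p u v =
    ∑ j, OneForm.wedge (F.basisForm 0 j) (conn j i) p u v +
    ∑ j, a j p * OneForm.wedge (F.basisForm 0 j) (F.basisForm 0 i) p u v) ∧
  (∀ i p u v, (F.basisForm 1 i).d p u v =
    ∑ j, OneForm.wedge (F.basisForm 1 j) (conn j i) p u v -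
    ∑ j, a j p * OneForm.wedge (F.basisForm 1 j) (F.basisForm 1 i) p u v)

/-- `pd i j = p_ij` and `qd i j = q_ij` are the Pfaffian derivatives of the covector:
`da_i - a_j ω_i^j = p_ij ω₁^j + q_ij ω₂^j`. -/
def IsPfaffianDerivative (conn : Fin 2 → Fin 2 → OneForm N P) (a : Fin 2 → P → ℝ)
    (pd qd : Fin 2 → Fin 2 → P → ℝ) : Prop :=
  ∀ i p (v : TangentSpace (𝓡 N) p),
    OneForm.differential (a i) p v - ∑ j, a j p * conn i j p v =
      ∑ j, pd i j p * F.basisForm 0 j p v + ∑ j, qd i j p * F.basisForm 1 j p v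

/-- `v` is annihilated by all the basis forms `ω_α^i`. -/
def IsVertical (p : P) (v : TangentSpace (𝓡 N) p) : Prop :=
  ∀ α i, F.basisForm α i p v = 0

/-- The tangent plane of the web at `proj p` with equations `c₁ θ_α¹ + c₂ θ_α² = 0`,
`α = 1, 2`. -/
def plane (p : P) (c : Fin 2 → ℝ) : Submodule ℝ (TangentSpace (𝓡 4) (F.proj p)) :=
  ⨅ α, LinearMap.ker (∑ i, c i • F.θ α i p).toLinearMap

/-- The transversal `a`-distribution of the web: `a₁ ω_α¹ + a₂ ω_α² = 0`, `α = 1, 2`, for every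
coframe of the family at the point (when `a` is the covector of the web, these equations define
the same plane for all of them). -/
def aDistribution (a : Fin 2 → P → ℝ) : TangentDistribution X :=
  fun x => ⨅ (p : P) (h : F.proj p = x), h ▸ F.plane p (fun i => a i p)

end AdaptedCoframes

end Web

end

noncomputable section

/-! ### Pullback of one-forms to a vector space -/

section Pullback

open Filter Topology

variable {E : Type*} [NormedAddCommGroup E] [NormedSpace ℝ E]

/-! In each of the three cases a = ρc with c a constant covector and ρ a nowhere zero function. Let
e span the kernel of c. A vector tangent to Δ has components ω_α^i = s_α e^i, and everything is
governed by the single form τ = e^i c_j ω_i^j.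

Since e^i a_i vanishes identically, contracting the Pfaffian equation with e gives -ρτ = (e^i e^j
p_ij) s₁ + (e^i e^j q_ij) s₂ on such vectors (`contraction_conn_eq`). In c_i dω_α^i the torsion
terms cancel, because both arguments are multiples of the same e, and r_α τ(v) - s_α τ(u) remains
(`contraction_d_eq`). So the Frobenius condition for Δ is τ = 0 along Δ, that is, the vanishing of
the quadratic forms p and q on e. Taking e = (0,1), (1,0), (1,-1) gives the three criteria.

The forms live on the parameter space P of coframes, so all computations are done after pulling them
back along local lifts of maps into X; `OneForm.d_pullback` transports the structure equations.
Since Δ is defined by all coframes over a point at once, one also has to know that a_i ω_α^i does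
not depend on the coframe. This is `torsionCovector_eq`, obtained by comparing the structure
equations of two lifts.

Necessity: both equations of Δ vanish on an integral surface, hence so do their differentials.
Sufficiency: in coordinates where the first two foliations are the factors of a product Y × Z, Δ is
the sum of a line field along Y and one along Z. The Frobenius condition says that the slope of each
is constant along the other, so the integral surface is a product of two curves
(`exists_product_integral_surface`). -/

theorem extDeriv_ofSubsingleton_apply {f : E → E →L[ℝ] ℝ} {x : E} (hf : DifferentiableAt ℝ f x)
    (u v : E) :
    extDeriv (fun y => ContinuousAlternatingMap.ofSubsingleton ℝ E ℝ (0 : Fin 1) (f y)) x ![u, v] =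
      fderiv ℝ f x u v - fderiv ℝ f x v u := by
  have h : DifferentiableAt ℝ
      (fun y => ContinuousAlternatingMap.ofSubsingleton ℝ E ℝ (0 : Fin 1) (f y)) x := by
    exact (ContinuousAlternatingMap.ofSubsingletonLIE (𝕜 := ℝ) (E := E) (F := ℝ)
      (0 : Fin 1)).toContinuousLinearEquiv.differentiableAt.comp x hf
  rw [extDeriv_apply h]
  have key : ∀ a b : E, fderiv ℝ (fun y => f y a) x b = fderiv ℝ f x b a := by
    intro a b
    rw [fderiv_clm_apply hf (differentiableAt_const a)]
    simp
  simp [Fin.sum_univ_two, Fin.removeNth, key, sub_eq_add_neg]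

namespace OneForm

variable {N : ℕ} {M : Type*} [TopologicalSpace M] [ChartedSpace (EuclideanSpace ℝ (Fin N)) M]

/-- The pullback of a one-form under a map from a vector space to a manifold. -/
def pullback (ψ : E → M) (η : OneForm N M) (w : E) : E →L[ℝ] ℝ :=
  (η (ψ w)).comp (mfderiv 𝓘(ℝ, E) (𝓡 N) ψ w)

variable [IsManifold (𝓡 N) ∞ M]

/-- Keeping the chart at ψ w₀ fixed while w varies expresses the pullback through maps between
vector spaces, in the very chart in which `OneForm.d` is computed at ψ w₀. -/
theorem pullback_eventuallyEq {ψ : E → M} {w₀ : E} (hψ : ContMDiffAt 𝓘(ℝ, E) (𝓡 N) ∞ ψ w₀)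
    (η : OneForm N M) :
    pullback ψ η =ᶠ[𝓝 w₀] fun w =>
      (η.inChart (ψ w₀) (extChartAt (𝓡 N) (ψ w₀) (ψ w))).comp
        (fderiv ℝ (fun z => extChartAt (𝓡 N) (ψ w₀) (ψ z)) w) := by
  have h1 : ∀ᶠ w in 𝓝 w₀, ContMDiffAt 𝓘(ℝ, E) (𝓡 N) 1 ψ w :=
    (contMDiffAt_iff_contMDiffAt_nhds (by simp)).1 (hψ.of_le (by norm_cast))
  have h2 : ∀ᶠ w in 𝓝 w₀, ψ w ∈ (extChartAt (𝓡 N) (ψ w₀)).source :=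
    hψ.continuousAt.eventually (extChartAt_source_mem_nhds _)
  filter_upwards [h1, h2, h2.eventually_nhds] with w hw1 hw2 hw3
  set κ := extChartAt (𝓡 N) (ψ w₀)
  have hd : MDifferentiableAt 𝓘(ℝ, E) (𝓡 N) ψ w := hw1.mdifferentiableAt (by simp)
  have hκ : MDifferentiableAt (𝓡 N) 𝓘(ℝ, EuclideanSpace ℝ (Fin N)) κ (ψ w) :=
    mdifferentiableAt_extChartAt (by simpa [κ] using hw2)
  have hsymm : MDifferentiableAt 𝓘(ℝ, EuclideanSpace ℝ (Fin N)) (𝓡 N) κ.symm (κ (ψ w)) := by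
    have := mdifferentiableWithinAt_extChartAt_symm (I := 𝓡 N) (κ.map_source hw2)
    rwa [ModelWithCorners.range_eq_univ, mdifferentiableWithinAt_univ] at this
  have hcomp : MDifferentiableAt 𝓘(ℝ, E) 𝓘(ℝ, EuclideanSpace ℝ (Fin N)) (fun z => κ (ψ z)) w :=
    hκ.comp w hd
  have heq : ψ =ᶠ[𝓝 w] κ.symm ∘ (fun z => κ (ψ z)) := by
    filter_upwards [hw3] with z hz
    exact (κ.left_inv hz).symm
  have hl : κ.symm (κ (ψ w)) = ψ w := κ.left_inv hw2
  have hchain : mfderiv 𝓘(ℝ, E) (𝓡 N) (κ.symm ∘ (fun z => κ (ψ z))) w =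
      (mfderiv 𝓘(ℝ, EuclideanSpace ℝ (Fin N)) (𝓡 N) κ.symm (κ (ψ w))).comp
        (fderiv ℝ (fun z => κ (ψ z)) w) := by
    rw [mfderiv_comp w hsymm hcomp, mfderiv_eq_fderiv]
    rfl
  unfold pullback inChart
  rw [heq.mfderiv_eq, hchain]
  change _ = ((η (κ.symm (κ (ψ w)))).comp _).comp _
  rw [hl]
  rfl

theorem contDiffAt_pullback {ψ : E → M} {w₀ : E} (hψ : ContMDiffAt 𝓘(ℝ, E) (𝓡 N) ∞ ψ w₀)
    {η : OneForm N M} (hη : η.IsSmooth) : ContDiffAt ℝ ∞ (pullback ψ η) w₀ := by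
  have hc : ContDiffAt ℝ ∞ (fun z => extChartAt (𝓡 N) (ψ w₀) (ψ z)) w₀ := by
    rw [← contMDiffAt_iff_contDiffAt]
    exact (contMDiffAt_extChartAt (I := 𝓡 N)).comp w₀ hψ
  refine ContDiffAt.congr_of_eventuallyEq ?_ (pullback_eventuallyEq hψ η)
  have h1 : ContDiffAt ℝ ∞ (η.inChart (ψ w₀)) (extChartAt (𝓡 N) (ψ w₀) (ψ w₀)) :=
    (hη (ψ w₀)).contDiffAt (extChartAt_target_mem_nhds _)
  exact ContDiffAt.clm_comp (ContDiffAt.comp (g := η.inChart (ψ w₀))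
    (f := fun z => extChartAt (𝓡 N) (ψ w₀) (ψ z)) w₀ h1 hc) (hc.fderiv_right (m := ∞) (by simp))

/-- Differentiating the chart expression yields one term with the second derivative of the chart
representative c of ψ, which is symmetric and cancels, and one with the derivative of the form,
which is dη. -/
theorem d_pullback {ψ : E → M} {w₀ : E} (hψ : ContMDiffAt 𝓘(ℝ, E) (𝓡 N) ∞ ψ w₀)
    {η : OneForm N M} (hη : η.IsSmooth) (u v : E) :
    fderiv ℝ (pullback ψ η) w₀ u v - fderiv ℝ (pullback ψ η) w₀ v u =
      η.d (ψ w₀) (mfderiv 𝓘(ℝ, E) (𝓡 N) ψ w₀ u) (mfderiv 𝓘(ℝ, E) (𝓡 N) ψ w₀ v) := by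
  set c : E → EuclideanSpace ℝ (Fin N) := fun z => extChartAt (𝓡 N) (ψ w₀) (ψ z) with hcdef
  have hc : ContDiffAt ℝ ∞ c w₀ := by
    rw [← contMDiffAt_iff_contDiffAt]
    exact (contMDiffAt_extChartAt (I := 𝓡 N)).comp w₀ hψ
  have h1 : ContDiffAt ℝ ∞ (η.inChart (ψ w₀)) (c w₀) :=
    (hη (ψ w₀)).contDiffAt (extChartAt_target_mem_nhds _)
  have h1d : DifferentiableAt ℝ (η.inChart (ψ w₀)) (c w₀) := h1.differentiableAt (by simp)
  have hcd : DifferentiableAt ℝ c w₀ := hc.differentiableAt (by simp)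
  have hcd2 : DifferentiableAt ℝ (fderiv ℝ c) w₀ :=
    (hc.fderiv_right (m := ∞) (by simp)).differentiableAt (by simp)
  have hF : ∀ a b : E, fderiv ℝ (pullback ψ η) w₀ a b =
      η.inChart (ψ w₀) (c w₀) (fderiv ℝ (fderiv ℝ c) w₀ a b) +
      fderiv ℝ (η.inChart (ψ w₀)) (c w₀) (fderiv ℝ c w₀ a) (fderiv ℝ c w₀ b) := by
    intro a b
    rw [(pullback_eventuallyEq hψ η).fderiv_eq]
    have := fderiv_clm_comp (h1d.comp w₀ hcd) hcd2
    simp only [Function.comp_def] at this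
    rw [this, fderiv_fun_comp _ h1d hcd]
    simp
  have hsym := hc.isSymmSndFDerivAt (by simp; norm_cast)
  have hm : ∀ a : E, mfderiv (𝓡 N) 𝓘(ℝ, EuclideanSpace ℝ (Fin N)) (extChartAt (𝓡 N) (ψ w₀))
      (ψ w₀) (mfderiv 𝓘(ℝ, E) (𝓡 N) ψ w₀ a) = fderiv ℝ c w₀ a := by
    intro a
    have hκ : MDifferentiableAt (𝓡 N) 𝓘(ℝ, EuclideanSpace ℝ (Fin N))
        (extChartAt (𝓡 N) (ψ w₀)) (ψ w₀) := mdifferentiableAt_extChartAt (by simp)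
    have := mfderiv_comp w₀ hκ (hψ.mdifferentiableAt (by simp))
    rw [mfderiv_eq_fderiv] at this
    exact (DFunLike.congr_fun this a).symm
  rw [hF, hF, hsym u v, OneForm.d, hm, hm]
  refine Eq.trans ?_ (extDeriv_ofSubsingleton_apply h1d _ _).symm
  ring

end OneForm

end Pullback

/-! ### Local sections of submersions and local inverses -/

section LocalSections

open Filter Topology

theorem Manifold.IsSubmersionAt.exists_local_section {N n : ℕ}
    {P : Type*} [TopologicalSpace P] [ChartedSpace (EuclideanSpace ℝ (Fin N)) P]
    [IsManifold (𝓡 N) ∞ P]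
    {X : Type*} [TopologicalSpace X] [ChartedSpace (EuclideanSpace ℝ (Fin n)) X]
    [IsManifold (𝓡 n) ∞ X] {f : P → X} {p : P}
    (hf : Manifold.IsSubmersionAt (𝓡 N) (𝓡 n) ∞ f p) :
    ∃ s : X → P, s (f p) = p ∧ (∀ᶠ y in 𝓝 (f p), ContMDiffAt (𝓡 n) (𝓡 N) ∞ s y) ∧
      ∀ᶠ y in 𝓝 (f p), f (s y) = y := by
  set D := hf.domChart with hD
  set C := hf.codChart with hC
  set e := hf.equiv with he
  have hpD : p ∈ D.source := hf.mem_domChart_source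
  have hpC : f p ∈ C.source := hf.mem_codChart_source
  have hpt : D.extend (𝓡 N) p ∈ (D.extend (𝓡 N)).target :=
    (D.extend (𝓡 N)).map_source (by simpa using hpD)
  have hw : ∀ z ∈ (D.extend (𝓡 N)).target,
      C.extend (𝓡 n) (f ((D.extend (𝓡 N)).symm z)) = (e z).1 := fun z hz => hf.writtenInCharts hz
  have hDp : (D.extend (𝓡 N)).symm (D.extend (𝓡 N) p) = p :=
    (D.extend (𝓡 N)).left_inv (by simpa using hpD)
  have h0 : C.extend (𝓡 n) (f p) = (e (D.extend (𝓡 N) p)).1 := by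
    simpa only [hDp] using hw _ hpt
  -- In submersion charts f is the first projection; the section freezes the fibre coordinate at its
  -- value at p.
  set l : EuclideanSpace ℝ (Fin n) → EuclideanSpace ℝ (Fin N) :=
    fun y => e.symm (y, (e (D.extend (𝓡 N) p)).2) with hl
  have hl0 : l (C.extend (𝓡 n) (f p)) = D.extend (𝓡 N) p := by
    simp only [hl, h0, Prod.mk.eta, ContinuousLinearEquiv.symm_apply_apply]
  have hlc : ContDiff ℝ ∞ l := by
    apply e.symm.contDiff.comp
    fun_prop
  have hCs : ∀ y ∈ C.source,
      ContMDiffAt (𝓡 n) 𝓘(ℝ, EuclideanSpace ℝ (Fin n)) ∞ (C.extend (𝓡 n)) y := fun y hy =>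
    (C.contMDiffOn_extend hf.codChart_mem_maximalAtlas).contMDiffAt (C.open_source.mem_nhds hy)
  have hlC : ∀ y ∈ C.source, ContMDiffAt (𝓡 n) 𝓘(ℝ, EuclideanSpace ℝ (Fin N)) ∞
      (fun y => l (C.extend (𝓡 n) y)) y := fun y hy =>
    hlc.contMDiff.contMDiffAt.comp y (hCs y hy)
  have hopen : IsOpen (D.extend (𝓡 N)).target := D.isOpen_extend_target
  have hDs : ∀ z ∈ (D.extend (𝓡 N)).target,
      ContMDiffAt 𝓘(ℝ, EuclideanSpace ℝ (Fin N)) (𝓡 N) ∞ (D.extend (𝓡 N)).symm z := by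
    intro z hz
    have := contMDiffOn_extend_symm (I := 𝓡 N) hf.domChart_mem_maximalAtlas
    refine this.contMDiffAt ?_
    simpa [OpenPartialHomeomorph.extend_target] using hopen.mem_nhds hz
  have h1 : ∀ᶠ y in 𝓝 (f p), l (C.extend (𝓡 n) y) ∈ (D.extend (𝓡 N)).target := by
    refine (hlC _ hpC).continuousAt.eventually ?_
    simp only [hl0]
    exact hopen.mem_nhds hpt
  refine ⟨fun y => (D.extend (𝓡 N)).symm (l (C.extend (𝓡 n) y)), ?_, ?_, ?_⟩
  · simp only [hl0, hDp]
  · filter_upwards [h1, C.open_source.mem_nhds hpC] with y hy hyC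
    exact (hDs _ hy).comp y (hlC y hyC)
  · filter_upwards [h1, C.open_source.mem_nhds hpC] with y hy hyC
    have hs := (D.extend (𝓡 N)).map_target hy
    rw [OpenPartialHomeomorph.extend_source] at hs
    have hfs := hf.source_subset_preimage_source hs
    have := hw _ hy
    simp only [hl, ContinuousLinearEquiv.apply_symm_apply] at this
    refine (C.extend (𝓡 n)).injOn ?_ ?_ this
    · rw [OpenPartialHomeomorph.extend_source]; exact hfs
    · rw [OpenPartialHomeomorph.extend_source]; exact hyC

/-- The inverse function theorem, with smoothness of the local inverse on a neighbourhood. -/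
theorem ContDiffAt.eventually_localInverse {E F : Type*} [NormedAddCommGroup E] [NormedSpace ℝ E]
    [CompleteSpace E] [NormedAddCommGroup F] [NormedSpace ℝ F] {f : E → F} {f' : E ≃L[ℝ] F} {a : E}
    (hf : ∀ᶠ y in 𝓝 a, ContDiffAt ℝ ∞ f y) (hf' : HasFDerivAt f (f' : E →L[ℝ] F) a)
    (hn : (∞ : WithTop ℕ∞) ≠ 0) :
    ∀ᶠ w in 𝓝 (f a), ContDiffAt ℝ ∞ (hf.self_of_nhds.localInverse hf' hn) w := by
  set R := hf.self_of_nhds.toOpenPartialHomeomorph f hf' hn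
  have hsrc : a ∈ R.source := hf.self_of_nhds.mem_toOpenPartialHomeomorph_source hf' hn
  have htgt : f a ∈ R.target := hf.self_of_nhds.image_mem_toOpenPartialHomeomorph_target hf' hn
  have hRa : R.symm (f a) = a := R.left_inv hsrc
  have hcont : ContinuousAt (fderiv ℝ f) a :=
    (hf.self_of_nhds.fderiv_right (m := 0) (by simp)).continuousAt
  -- Invertibility of the derivative is an open condition, so the local inverse is smooth at nearby
  -- points as well as at f a.
  have hequiv : ∀ᶠ y in 𝓝 a, fderiv ℝ f y ∈ Set.range ((↑) : (E ≃L[ℝ] F) → E →L[ℝ] F) := by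
    refine hcont.eventually ?_
    rw [hf'.fderiv]
    exact ContinuousLinearEquiv.nhds f'
  have hsymm : ContinuousAt R.symm (f a) := R.continuousAt_symm htgt
  rw [ContinuousAt, hRa] at hsymm
  filter_upwards [R.open_target.mem_nhds htgt, hsymm.eventually hf, hsymm.eventually hequiv]
    with w hw1 hw2 hw3
  obtain ⟨A, hA⟩ := hw3
  refine R.contDiffAt_symm hw1 (f₀' := A) ?_ hw2
  rw [hA]
  exact (hw2.differentiableAt (by simp)).hasFDerivAt

theorem exists_local_inverse {n : ℕ}
    {X : Type*} [TopologicalSpace X] [ChartedSpace (EuclideanSpace ℝ (Fin n)) X]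
    [IsManifold (𝓡 n) ∞ X] {F : Type*} [NormedAddCommGroup F] [NormedSpace ℝ F]
    [CompleteSpace F] {f : X → F} {x : X}
    (hf : ∀ᶠ y in 𝓝 x, ContMDiffAt (𝓡 n) 𝓘(ℝ, F) ∞ f y)
    (hbij : Function.Bijective (mfderiv (𝓡 n) 𝓘(ℝ, F) f x)) :
    ∃ G : F → X, G (f x) = x ∧ (∀ᶠ w in 𝓝 (f x), ContMDiffAt 𝓘(ℝ, F) (𝓡 n) ∞ G w) ∧
      ∀ᶠ w in 𝓝 (f x), f (G w) = w := by
  set κ := extChartAt (𝓡 n) x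
  have hκx : κ.symm (κ x) = x := κ.left_inv (mem_extChartAt_source x)
  have htn : κ.target ∈ 𝓝 (κ x) := extChartAt_target_mem_nhds x
  have hsymm : ∀ᶠ z in 𝓝 (κ x),
      ContMDiffAt 𝓘(ℝ, EuclideanSpace ℝ (Fin n)) (𝓡 n) ∞ κ.symm z := by
    filter_upwards [eventually_mem_nhds_iff.2 htn] with z hz
    exact (contMDiffOn_extChartAt_symm x).contMDiffAt hz
  have hg : ∀ᶠ z in 𝓝 (κ x), ContDiffAt ℝ ∞ (f ∘ κ.symm) z := by
    have h1 : Tendsto κ.symm (𝓝 (κ x)) (𝓝 x) := by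
      have := hsymm.self_of_nhds.continuousAt
      rwa [ContinuousAt, hκx] at this
    filter_upwards [hsymm, h1.eventually hf] with z hz1 hz2
    rw [← contMDiffAt_iff_contDiffAt]
    exact hz2.comp z hz1
  have hinv : (mfderiv 𝓘(ℝ, EuclideanSpace ℝ (Fin n)) (𝓡 n) κ.symm (κ x)).IsInvertible := by
    have := isInvertible_mfderivWithin_extChartAt_symm (I := 𝓡 n) (mem_extChartAt_target x)
    rwa [ModelWithCorners.range_eq_univ, mfderivWithin_univ] at this
  have hd : Function.Bijective (fderiv ℝ (f ∘ κ.symm) (κ x)) := by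
    rw [← mfderiv_eq_fderiv, mfderiv_comp (I' := 𝓡 n) (κ x)
      (by rw [hκx]; exact hf.self_of_nhds.mdifferentiableAt (by simp)) (hsymm.self_of_nhds.mdifferentiableAt (by simp))]
    refine Function.Bijective.comp (g := mfderiv (𝓡 n) 𝓘(ℝ, F) f (κ.symm (κ x))) ?_ hinv.bijective
    rw [hκx]; exact hbij
  set A : EuclideanSpace ℝ (Fin n) ≃L[ℝ] F :=
    ContinuousLinearEquiv.ofBijective (fderiv ℝ (f ∘ κ.symm) (κ x))
      (LinearMap.ker_eq_bot.2 hd.1) (LinearMap.range_eq_top.2 hd.2)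
  have hA : HasFDerivAt (f ∘ κ.symm) (A : EuclideanSpace ℝ (Fin n) →L[ℝ] F) (κ x) := by
    rw [ContinuousLinearEquiv.coe_ofBijective]
    exact (hg.self_of_nhds.differentiableAt (by simp)).hasFDerivAt
  have hn : (∞ : WithTop ℕ∞) ≠ 0 := by simp
  have hfx : (f ∘ κ.symm) (κ x) = f x := by simp [hκx]
  have hloc0 : hg.self_of_nhds.localInverse hA hn (f x) = κ x := by
    have := hg.self_of_nhds.localInverse_apply_image hA hn
    rwa [hfx] at this
  have hlocs := ContDiffAt.eventually_localInverse hg hA hn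
  rw [hfx] at hlocs
  have hlt : Tendsto (hg.self_of_nhds.localInverse hA hn) (𝓝 (f x)) (𝓝 (κ x)) := by
    have := hlocs.self_of_nhds.continuousAt
    rwa [ContinuousAt, hloc0] at this
  refine ⟨fun w => κ.symm (hg.self_of_nhds.localInverse hA hn w), by simp only [hloc0, hκx], ?_, ?_⟩
  · filter_upwards [hlocs, hlt.eventually hsymm] with w hw1 hw2
    exact hw2.comp w hw1.contMDiffAt
  · have := (hg.self_of_nhds.hasStrictFDerivAt' hA hn).eventually_right_inverse
    rw [hfx] at this
    exact this

end LocalSections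

/-! ### Products of integral curves -/

section ProductSurface

open Filter Topology Set

/-- At a maximum of |g| + |h| on the square, with value M, integrating from the axes where g or h
vanishes bounds each term by CMε. Hence M ≤ 2CεM, which forces M = 0. -/
theorem eq_zero_of_coupled_deriv_le {g h : ℝ → ℝ → ℝ} {C ε : ℝ} (hε : 0 < ε) (hC : 0 ≤ C)
    (hCε : 2 * (C * ε) < 1)
    (hgc : ContinuousOn (fun p : ℝ × ℝ => g p.1 p.2) (Icc (-ε) ε ×ˢ Icc (-ε) ε))
    (hhc : ContinuousOn (fun p : ℝ × ℝ => h p.1 p.2) (Icc (-ε) ε ×ˢ Icc (-ε) ε))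
    (hg0 : ∀ t, g t 0 = 0) (hh0 : ∀ s, h 0 s = 0)
    (hg : ∀ t ∈ Icc (-ε) ε, ∀ s ∈ Icc (-ε) ε, ∃ d, HasDerivAt (fun s => g t s) d s ∧
      |d| ≤ C * |h t s|)
    (hh : ∀ t ∈ Icc (-ε) ε, ∀ s ∈ Icc (-ε) ε, ∃ d, HasDerivAt (fun t => h t s) d t ∧
      |d| ≤ C * |g t s|) :
    ∀ t ∈ Icc (-ε) ε, ∀ s ∈ Icc (-ε) ε, g t s = 0 ∧ h t s = 0 := by
  have h00 : (0 : ℝ) ∈ Icc (-ε) ε := ⟨by linarith, hε.le⟩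
  obtain ⟨q, hq, hmax⟩ := (isCompact_Icc.prod isCompact_Icc).exists_isMaxOn
    ⟨((0 : ℝ), (0 : ℝ)), h00, h00⟩ (hgc.abs.add hhc.abs)
  set M := |g q.1 q.2| + |h q.1 q.2| with hM
  have hle : ∀ t ∈ Icc (-ε) ε, ∀ s ∈ Icc (-ε) ε, |g t s| + |h t s| ≤ M :=
    fun t ht s hs => hmax (show (t, s) ∈ _ from ⟨ht, hs⟩)
  have hM0 : 0 ≤ M := by positivity
  have hgle : ∀ t ∈ Icc (-ε) ε, ∀ s ∈ Icc (-ε) ε, |g t s| ≤ C * M * ε := by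
    intro t ht s hs
    choose! d hd hdb using hg t ht
    have := (convex_Icc (-ε) ε).norm_image_sub_le_of_norm_hasDerivWithin_le (C := C * M)
      (fun r hr => (hd r hr).hasDerivWithinAt)
      (fun r hr => (hdb r hr).trans (mul_le_mul_of_nonneg_left
        (by linarith [hle t ht r hr, abs_nonneg (g t r)]) hC)) h00 hs
    rw [hg0, sub_zero, sub_zero, Real.norm_eq_abs, Real.norm_eq_abs] at this
    exact this.trans (mul_le_mul_of_nonneg_left (abs_le.2 hs) (by positivity))
  have hhle : ∀ t ∈ Icc (-ε) ε, ∀ s ∈ Icc (-ε) ε, |h t s| ≤ C * M * ε := by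
    intro t ht s hs
    have hh' : ∀ t ∈ Icc (-ε) ε, ∃ d, HasDerivAt (fun t => h t s) d t ∧ |d| ≤ C * |g t s| :=
      fun t ht => hh t ht s hs
    choose! d hd hdb using hh'
    have := (convex_Icc (-ε) ε).norm_image_sub_le_of_norm_hasDerivWithin_le (C := C * M)
      (fun r hr => (hd r hr).hasDerivWithinAt)
      (fun r hr => (hdb r hr).trans (mul_le_mul_of_nonneg_left
        (by linarith [hle r hr s hs, abs_nonneg (h r s)]) hC)) h00 ht
    rw [hh0, sub_zero, sub_zero, Real.norm_eq_abs, Real.norm_eq_abs] at this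
    exact this.trans (mul_le_mul_of_nonneg_left (abs_le.2 ht) (by positivity))
  have hMz : M = 0 := by
    have h1 : M ≤ 2 * (C * ε) * M := by
      have := add_le_add (hgle _ hq.1 _ hq.2) (hhle _ hq.1 _ hq.2)
      calc M ≤ _ := this
        _ = _ := by ring
    nlinarith
  intro t ht s hs
  have := hle t ht s hs
  have a1 := abs_nonneg (g t s)
  have a2 := abs_nonneg (h t s)
  exact ⟨abs_eq_zero.1 (by linarith), abs_eq_zero.1 (by linarith)⟩

/-- Picard–Lindelöf gives a differentiable solution; the regularity theorem for ODEs makes it smooth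
on a closed interval along which V is smooth. -/
theorem exists_smooth_integral_curve {Y : Type*} [NormedAddCommGroup Y] [NormedSpace ℝ Y]
    [CompleteSpace Y] {V : Y → Y} {y₀ : Y} (hV : ∀ᶠ y in 𝓝 y₀, ContDiffAt ℝ ∞ V y) :
    ∃ y : ℝ → Y, y 0 = y₀ ∧ ∀ᶠ t in 𝓝 (0 : ℝ), HasDerivAt y (V (y t)) t ∧
      ContDiffAt ℝ ∞ y t := by
  obtain ⟨y, hy0, ε, hε, hy⟩ := (hV.self_of_nhds.of_le (m := 1)
    (by norm_cast)).exists_forall_mem_closedBall_exists_eq_forall_mem_Ioo_hasDerivAt₀ 0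
  simp only [zero_sub, zero_add] at hy
  have hyc : ContinuousAt y 0 := (hy 0 ⟨by linarith, hε⟩).continuousAt
  rw [ContinuousAt, hy0] at hyc
  obtain ⟨δ, hδ, hball⟩ := Metric.eventually_nhds_iff_ball.1 (hyc.eventually hV)
  set r := min (ε / 2) (δ / 2) with hr
  have hr0 : 0 < r := by positivity
  have hrε : r < ε := (min_le_left _ _).trans_lt (by linarith)
  have hrδ : r < δ := (min_le_right _ _).trans_lt (by linarith)
  have hV' : ∀ t ∈ Icc (-r) r, ContDiffAt ℝ ∞ V (y t) := by
    intro t ht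
    refine hball t ?_
    rw [Metric.mem_ball, dist_zero_right, Real.norm_eq_abs]
    exact (abs_le.2 ht).trans_lt hrδ
  have hd : ∀ t ∈ Icc (-r) r, HasDerivAt y (V (y t)) t := fun t ht =>
    hy t ⟨by linarith [ht.1], by linarith [ht.2]⟩
  have hsmooth : ContDiffOn ℝ ∞ y (Icc (-r) r) := by
    refine ODE.contDiffOn_enat_Icc_of_hasDerivWithinAt (n := ⊤) (f := fun _ => V)
      (u := {x | ContDiffAt ℝ ∞ V x}) ?_ (fun t ht => (hd t ht).hasDerivWithinAt) hV'
    rintro ⟨t, x⟩ ⟨-, hx⟩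
    replace hx : ContDiffAt ℝ ∞ V x := hx
    exact (ContDiffAt.comp (g := V) (f := Prod.snd) (t, x) hx contDiffAt_snd).contDiffWithinAt
  refine ⟨y, hy0, ?_⟩
  filter_upwards [Ioo_mem_nhds (neg_neg_iff_pos.2 hr0) hr0] with t ht
  exact ⟨hd t (Ioo_subset_Icc_self ht), hsmooth.contDiffAt (Icc_mem_nhds ht.1 ht.2)⟩

/-- The curve y integrates the line field along Y with z frozen at z₀, and z the one along Z with y
frozen at y₀. That the slopes at (y t, z s) agree with the frozen ones is a uniqueness statement:
the two discrepancies satisfy the coupled inequalities of `eq_zero_of_coupled_deriv_le`. -/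
theorem exists_product_integral_surface {Y Z : Type*} [NormedAddCommGroup Y] [NormedSpace ℝ Y]
    [CompleteSpace Y] [NormedAddCommGroup Z] [NormedSpace ℝ Z] [CompleteSpace Z]
    {γ β : Y × Z → ℝ} {y₀ : Y} {z₀ : Z} {u₁ u₂ : Y} {v₁ v₂ : Z}
    (hγ : ∀ᶠ w in 𝓝 (y₀, z₀), ContDiffAt ℝ ∞ γ w) (hβ : ∀ᶠ w in 𝓝 (y₀, z₀), ContDiffAt ℝ ∞ β w)
    (hγ0 : ∀ᶠ w in 𝓝 (y₀, z₀), fderiv ℝ γ w (0, v₁ + β w • v₂) = 0)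
    (hβ0 : ∀ᶠ w in 𝓝 (y₀, z₀), fderiv ℝ β w (u₁ + γ w • u₂, 0) = 0) :
    ∃ (y : ℝ → Y) (z : ℝ → Z) (ε : ℝ), 0 < ε ∧ y 0 = y₀ ∧ z 0 = z₀ ∧
      ∀ t ∈ Ioo (-ε) ε, ∀ s ∈ Ioo (-ε) ε, ContDiffAt ℝ ∞ y t ∧ ContDiffAt ℝ ∞ z s ∧
        HasDerivAt y (u₁ + γ (y t, z s) • u₂) t ∧ HasDerivAt z (v₁ + β (y t, z s) • v₂) s := by
  have hY : Continuous fun y : Y => (y, z₀) := by fun_prop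
  have hZ : Continuous fun z : Z => (y₀, z) := by fun_prop
  obtain ⟨y, hy0, hy⟩ := exists_smooth_integral_curve (V := fun y => u₁ + γ (y, z₀) • u₂)
    (y₀ := y₀) (by
      filter_upwards [hY.tendsto y₀ |>.eventually hγ] with y hy
      have h1 : ContDiffAt ℝ ∞ (fun y => γ (y, z₀)) y :=
        ContDiffAt.comp (g := γ) y hy (contDiffAt_id.prodMk contDiffAt_const)
      exact contDiffAt_const.add (h1.smul contDiffAt_const))
  obtain ⟨z, hz0, hz⟩ := exists_smooth_integral_curve (V := fun z => v₁ + β (y₀, z) • v₂)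
    (y₀ := z₀) (by
      filter_upwards [hZ.tendsto z₀ |>.eventually hβ] with z hz
      have h1 : ContDiffAt ℝ ∞ (fun z => β (y₀, z)) z :=
        ContDiffAt.comp (g := β) z hz (contDiffAt_const.prodMk contDiffAt_id)
      exact contDiffAt_const.add (h1.smul contDiffAt_const))
  have hyc := hy.self_of_nhds.2.continuousAt
  have hzc := hz.self_of_nhds.2.continuousAt
  rw [ContinuousAt, hy0] at hyc
  rw [ContinuousAt, hz0] at hzc
  have hγc : ContinuousAt (fun w => |fderiv ℝ γ w (0, v₂)|) (y₀, z₀) :=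
    (((hγ.self_of_nhds.fderiv_right (m := 0) (by simp)).continuousAt).clm_apply
      continuousAt_const).abs
  have hβc : ContinuousAt (fun w => |fderiv ℝ β w (u₂, 0)|) (y₀, z₀) :=
    (((hβ.self_of_nhds.fderiv_right (m := 0) (by simp)).continuousAt).clm_apply
      continuousAt_const).abs
  -- The extra 1 makes the bound strict at the base point, so that it persists nearby.
  set C := max |fderiv ℝ γ (y₀, z₀) (0, v₂)| |fderiv ℝ β (y₀, z₀) (u₂, 0)| + 1 with hC
  have hC0 : 0 < C := by positivity
  have hγC : ∀ᶠ w in 𝓝 (y₀, z₀), |fderiv ℝ γ w (0, v₂)| ≤ C :=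
    (hγc.eventually_lt_const (by
      rw [hC]; exact (le_max_left _ _).trans_lt (lt_add_one _))).mono fun _ h => h.le
  have hβC : ∀ᶠ w in 𝓝 (y₀, z₀), |fderiv ℝ β w (u₂, 0)| ≤ C :=
    (hβc.eventually_lt_const (by
      rw [hC]; exact (le_max_right _ _).trans_lt (lt_add_one _))).mono fun _ h => h.le
  have hall := (hγ.and (hβ.and (hγ0.and (hβ0.and (hγC.and hβC)))))
  rw [nhds_prod_eq, eventually_prod_iff] at hall
  obtain ⟨pY, hpY, pZ, hpZ, hall⟩ := hall
  have hev := (hy.and (hyc.eventually hpY)).and (hz.and (hzc.eventually hpZ))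
  obtain ⟨δ, hδ, hball⟩ := Metric.eventually_nhds_iff_ball.1 hev
  obtain ⟨ε, hε, hεδ, hεC⟩ : ∃ ε > 0, ε < δ ∧ 2 * (C * ε) < 1 := by
    refine ⟨min (δ / 2) (1 / (4 * C)), by positivity, (min_le_left _ _).trans_lt (by linarith), ?_⟩
    have : C * min (δ / 2) (1 / (4 * C)) ≤ C * (1 / (4 * C)) :=
      mul_le_mul_of_nonneg_left (min_le_right _ _) hC0.le
    have h4 : C * (1 / (4 * C)) = 1 / 4 := by field_simp
    linarith
  have hIcc : ∀ t ∈ Icc (-ε) ε, t ∈ Metric.ball (0 : ℝ) δ := by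
    intro t ht
    rw [Metric.mem_ball, dist_zero_right, Real.norm_eq_abs]
    exact (abs_le.2 ht).trans_lt hεδ
  have hyI : ∀ t ∈ Icc (-ε) ε, _ := fun t ht => (hball t (hIcc t ht)).1
  have hzI : ∀ t ∈ Icc (-ε) ε, _ := fun t ht => (hball t (hIcc t ht)).2
  have hpt : ∀ t ∈ Icc (-ε) ε, ∀ s ∈ Icc (-ε) ε, _ := fun t ht s hs =>
    hall (hyI t ht).2 (hzI s hs).2
  have h00 : (0 : ℝ) ∈ Icc (-ε) ε := ⟨by linarith, hε.le⟩
  have hzero := eq_zero_of_coupled_deriv_le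
    (g := fun t s => γ (y t, z s) - γ (y t, z₀)) (h := fun t s => β (y t, z s) - β (y₀, z s))
    hε hC0.le hεC ?_ ?_ (by simp [hz0]) (by simp [hy0]) ?_ ?_
  · refine ⟨y, z, ε, hε, hy0, hz0, fun t ht s hs => ?_⟩
    have ht' := Ioo_subset_Icc_self ht
    have hs' := Ioo_subset_Icc_self hs
    obtain ⟨h1, h2⟩ := hzero t ht' s hs'
    refine ⟨(hyI t ht').1.2, (hzI s hs').1.2, ?_, ?_⟩
    · rw [sub_eq_zero.1 h1]; exact (hyI t ht').1.1
    · rw [sub_eq_zero.1 h2]; exact (hzI s hs').1.1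
  · rintro ⟨t, s⟩ ⟨ht, hs⟩
    have c1 : ContinuousAt (fun p : ℝ × ℝ => y p.1) (t, s) :=
      ContinuousAt.comp (g := y) (hyI t ht).1.2.continuousAt continuousAt_fst
    have c2 : ContinuousAt (fun p : ℝ × ℝ => z p.2) (t, s) :=
      ContinuousAt.comp (g := z) (hzI s hs).1.2.continuousAt continuousAt_snd
    have a1 : ContinuousAt (fun p : ℝ × ℝ => γ (y p.1, z p.2)) (t, s) :=
      ContinuousAt.comp (g := γ) (hpt t ht s hs).1.continuousAt (c1.prodMk c2)
    have a2 : ContinuousAt (fun p : ℝ × ℝ => γ (y p.1, z₀)) (t, s) :=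
      ContinuousAt.comp (g := γ) (by have := (hpt t ht 0 h00).1.continuousAt; rwa [hz0] at this)
        (c1.prodMk continuousAt_const)
    exact (a1.sub a2).continuousWithinAt
  · rintro ⟨t, s⟩ ⟨ht, hs⟩
    have c1 : ContinuousAt (fun p : ℝ × ℝ => y p.1) (t, s) :=
      ContinuousAt.comp (g := y) (hyI t ht).1.2.continuousAt continuousAt_fst
    have c2 : ContinuousAt (fun p : ℝ × ℝ => z p.2) (t, s) :=
      ContinuousAt.comp (g := z) (hzI s hs).1.2.continuousAt continuousAt_snd
    have a1 : ContinuousAt (fun p : ℝ × ℝ => β (y p.1, z p.2)) (t, s) :=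
      ContinuousAt.comp (g := β) (hpt t ht s hs).2.1.continuousAt (c1.prodMk c2)
    have a2 : ContinuousAt (fun p : ℝ × ℝ => β (y₀, z p.2)) (t, s) :=
      ContinuousAt.comp (g := β) (by have := (hpt 0 h00 s hs).2.1.continuousAt; rwa [hy0] at this)
        (continuousAt_const.prodMk c2)
    exact (a1.sub a2).continuousWithinAt
  · intro t ht s hs
    obtain ⟨hγd, -, hγz, -, hγb, -⟩ := hpt t ht s hs
    have hd : HasDerivAt (fun s => γ (y t, z s) - γ (y t, z₀))
        (fderiv ℝ γ (y t, z s) (0, v₁ + β (y₀, z s) • v₂)) s :=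
      (HasFDerivAt.comp_hasDerivAt (l := γ) s (hγd.differentiableAt (by simp)).hasFDerivAt
        ((hasDerivAt_const s (y t)).prodMk (hzI s hs).1.1)).sub_const _
    refine ⟨_, hd, ?_⟩
    -- The curve z moves with the frozen slope β(y₀, z s). Its velocity differs from the direction
    -- along which γ is constant by a multiple of v₂ whose coefficient is exactly h.
    have e1 : ((0 : Y), v₁ + β (y₀, z s) • v₂) = (0, v₁ + β (y t, z s) • v₂) -
        (β (y t, z s) - β (y₀, z s)) • ((0 : Y), v₂) := by
      ext <;> simp [sub_smul]; abel
    rw [e1, map_sub, hγz, map_smul, zero_sub, abs_neg, smul_eq_mul, abs_mul, mul_comm]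
    exact mul_le_mul_of_nonneg_right hγb (abs_nonneg _)
  · intro t ht s hs
    obtain ⟨-, hβd, -, hβz, -, hβb⟩ := hpt t ht s hs
    have hd : HasDerivAt (fun t => β (y t, z s) - β (y₀, z s))
        (fderiv ℝ β (y t, z s) (u₁ + γ (y t, z₀) • u₂, 0)) t :=
      (HasFDerivAt.comp_hasDerivAt (l := β) t (hβd.differentiableAt (by simp)).hasFDerivAt
        ((hyI t ht).1.1.prodMk (hasDerivAt_const t (z s)))).sub_const _
    refine ⟨_, hd, ?_⟩
    have e1 : (u₁ + γ (y t, z₀) • u₂, (0 : Z)) = (u₁ + γ (y t, z s) • u₂, 0) -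
        (γ (y t, z s) - γ (y t, z₀)) • (u₂, (0 : Z)) := by
      ext <;> simp [sub_smul]; abel
    rw [e1, map_sub, hβz, map_smul, zero_sub, abs_neg, smul_eq_mul, abs_mul, mul_comm]
    exact mul_le_mul_of_nonneg_right hβb (abs_nonneg _)

end ProductSurface

/-! ### Pointwise linear algebra of adapted coframes -/

/-- The first two foliations make the change block diagonal. The third forces the two blocks to be
equal, since the difference of corresponding dual vectors is tangent to it. -/
theorem exists_coframe_change {V : Type*} [AddCommGroup V] [Module ℝ V]
    {θ θ' : Fin 2 → Fin 2 → V →ₗ[ℝ] ℝ}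
    (hsurj : ∀ r : Fin 2 → Fin 2 → ℝ, ∃ v, ∀ α i, θ α i v = r α i)
    (h0 : ∀ v, (∀ i, θ 0 i v = 0) → ∀ i, θ' 0 i v = 0)
    (h1 : ∀ v, (∀ i, θ 1 i v = 0) → ∀ i, θ' 1 i v = 0)
    (h2 : ∀ v, (∀ i, θ 0 i v + θ 1 i v = 0) → ∀ i, θ' 0 i v + θ' 1 i v = 0) :
    ∃ B : Fin 2 → Fin 2 → ℝ, ∀ α i v, θ' α i v = ∑ k, B i k * θ α k v := by
  choose e he using fun (β k : Fin 2) =>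
    hsurj fun α i => if α = β ∧ i = k then 1 else 0
  refine ⟨fun i k => θ' 0 i (e 0 k), ?_⟩
  have e10 : ∀ i k, θ' 0 i (e 1 k) = 0 := fun i k => h0 _ (fun j => by simp [he]) i
  have e01 : ∀ i k, θ' 1 i (e 0 k) = 0 := fun i k => h1 _ (fun j => by simp [he]) i
  have e11 : ∀ i k, θ' 1 i (e 1 k) = θ' 0 i (e 0 k) := by
    intro i k
    have := h2 (e 0 k - e 1 k) (fun j => by simp [he]) i
    rw [map_sub, map_sub, e10, e01] at this
    linarith
  have key : ∀ v α i, θ' α i (v - ∑ β, ∑ k, θ β k v • e β k) = 0 := by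
    intro v α i
    have hz : ∀ α i, θ α i (v - ∑ β, ∑ k, θ β k v • e β k) = 0 := by
      intro α i
      fin_cases α <;> fin_cases i <;> simp [Fin.sum_univ_two, he]
    fin_cases α
    · exact h0 _ (hz 0) i
    · exact h1 _ (hz 1) i
  intro α i v
  have := key v α i
  fin_cases α
  · simp [Fin.sum_univ_two, e10] at this ⊢
    linarith
  · simp [Fin.sum_univ_two, e01, e11] at this ⊢
    linarith

/-- The transformation rule of the torsion covector under a change of adapted coframes with
matrix `A`, read off from the two systems of structure equations at a point. -/
theorem covector_transformation {V : Type*} {η η' κ κ' dA : Fin 2 → Fin 2 → V → ℝ}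
    {a a' : Fin 2 → ℝ} {A : Fin 2 → Fin 2 → ℝ} {e : Fin 2 → Fin 2 → V}
    (he : ∀ α i β k, η α i (e β k) = if α = β ∧ i = k then 1 else 0)
    (hη : ∀ α i v, η' α i v = ∑ k, A i k * η α k v)
    (hdet : A 0 0 * A 1 1 - A 0 1 * A 1 0 ≠ 0)
    (h0 : ∀ i u v, ∑ j, (η' 0 j u * κ' j i v - η' 0 j v * κ' j i u) +
        ∑ j, a' j * (η' 0 j u * η' 0 i v - η' 0 j v * η' 0 i u) =
      ∑ k, (dA i k u * η 0 k v - dA i k v * η 0 k u) +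
      ∑ k, A i k * (∑ j, (η 0 j u * κ j k v - η 0 j v * κ j k u) +
        ∑ j, a j * (η 0 j u * η 0 k v - η 0 j v * η 0 k u)))
    (h1 : ∀ i u v, ∑ j, (η' 1 j u * κ' j i v - η' 1 j v * κ' j i u) -
        ∑ j, a' j * (η' 1 j u * η' 1 i v - η' 1 j v * η' 1 i u) =
      ∑ k, (dA i k u * η 1 k v - dA i k v * η 1 k u) +
      ∑ k, A i k * (∑ j, (η 1 j u * κ j k v - η 1 j v * κ j k u) -
        ∑ j, a j * (η 1 j u * η 1 k v - η 1 j v * η 1 k u))) (k : Fin 2) :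
    a k = ∑ j, a' j * A j k := by
  -- T is the defect in the transformation law of the connection forms.
  set T : Fin 2 → Fin 2 → V → ℝ := fun i k v =>
    ∑ j, A j k * κ' j i v + dA i k v - ∑ l, A i l * κ k l v with hT
  -- The second system, evaluated on (e 1 k, e 0 l), has no torsion terms because its basis forms
  -- vanish on e 0 l; only T survives.
  have hT0 : ∀ i k l, T i k (e 0 l) = 0 := by
    intro i k l
    have := h1 i (e 1 k) (e 0 l)
    fin_cases k <;>
    · simp [hη, he, Fin.sum_univ_two, hT] at this ⊢
      linarith
  -- With T zero on the vectors e 0 l, the first system on (e 0 0, e 0 1) says that a'A - a is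
  -- proportional to every row of A, hence zero since A is invertible.
  have hb : ∀ i, (∑ j, a' j * A j 0 - a 0) * A i 1 = (∑ j, a' j * A j 1 - a 1) * A i 0 := by
    intro i
    have t1 := hT0 i 0 1
    have t2 := hT0 i 1 0
    have := h0 i (e 0 0) (e 0 1)
    simp [hη, he, Fin.sum_univ_two, hT] at this t1 t2 ⊢
    linear_combination this - t1 + t2
  have b0 := hb 0
  have b1 := hb 1
  have hk0 : (∑ j, a' j * A j 0 - a 0) * (A 0 0 * A 1 1 - A 0 1 * A 1 0) = 0 := by
    linear_combination A 0 0 * b1 - A 1 0 * b0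
  have hk1 : (∑ j, a' j * A j 1 - a 1) * (A 0 0 * A 1 1 - A 0 1 * A 1 0) = 0 := by
    linear_combination A 0 1 * b1 - A 1 1 * b0
  fin_cases k
  · exact (sub_eq_zero.1 ((mul_eq_zero.1 hk0).resolve_right hdet)).symm
  · exact (sub_eq_zero.1 ((mul_eq_zero.1 hk1).resolve_right hdet)).symm

section Coframes

open Filter Topology

variable {X : Type*} [TopologicalSpace X] [ChartedSpace (EuclideanSpace ℝ (Fin 4)) X]

/-- All tangent spaces are definitionally the model space, so moving a vector between equal points
needs no cast. -/
theorem ThreeWeb.mem_tangent_congr (W : ThreeWeb X) (ξ : Fin 3) {x y : X} (h : x = y)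
    (v : EuclideanSpace ℝ (Fin 4)) :
    Membership.mem (W.tangent ξ x) v ↔ Membership.mem (W.tangent ξ y) v := by
  subst h; rfl

namespace AdaptedCoframes

variable {W : ThreeWeb X} {N : ℕ} {P : Type*} [TopologicalSpace P]
  [ChartedSpace (EuclideanSpace ℝ (Fin N)) P] (F : AdaptedCoframes W N P)

/-- The covectors of the coframe, as linear forms on the model space. -/
def covector (α i : Fin 2) (p : P) : EuclideanSpace ℝ (Fin 4) →ₗ[ℝ] ℝ := (F.θ α i p).toLinearMap

theorem mem_tangent_zero (p : P) (v : TangentSpace (𝓡 4) (F.proj p)) :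
    v ∈ W.tangent 0 (F.proj p) ↔
      ∀ i, F.covector 0 i p v = 0 := by
  rw [F.adapted_one]; simp only [Submodule.mem_iInf, LinearMap.mem_ker]; rfl

theorem mem_tangent_one (p : P) (v : TangentSpace (𝓡 4) (F.proj p)) :
    v ∈ W.tangent 1 (F.proj p) ↔
      ∀ i, F.covector 1 i p v = 0 := by
  rw [F.adapted_two]; simp only [Submodule.mem_iInf, LinearMap.mem_ker]; rfl

theorem mem_tangent_two (p : P) (v : TangentSpace (𝓡 4) (F.proj p)) :
    v ∈ W.tangent 2 (F.proj p) ↔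
      ∀ i, F.covector 0 i p v + F.covector 1 i p v = 0 := by
  rw [F.adapted_three]; simp only [Submodule.mem_iInf, LinearMap.mem_ker]
  refine forall_congr' fun i => ?_
  exact neg_eq_zero

theorem mem_plane (p : P) (c : Fin 2 → ℝ) (v : TangentSpace (𝓡 4) (F.proj p)) :
    v ∈ F.plane p c ↔
      ∀ α, ∑ i, c i * F.covector α i p v = 0 := by
  simp only [plane, Submodule.mem_iInf, LinearMap.mem_ker, Fin.sum_univ_two]
  rfl

theorem mem_aDistribution (a : Fin 2 → P → ℝ) (x : X) (v : TangentSpace (𝓡 4) x) :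
    v ∈ F.aDistribution a x ↔
      ∀ p, F.proj p = x → ∀ α, ∑ i, a i p * F.covector α i p v = 0 := by
  simp only [aDistribution, Submodule.mem_iInf]
  refine forall_congr' fun p => forall_congr' fun h => ?_
  subst h
  exact F.mem_plane p _ v

theorem eq_zero_of_covector_eq_zero (p : P) {v : EuclideanSpace ℝ (Fin 4)}
    (h : ∀ α i, F.covector α i p v = 0) : v = 0 := by
  have h0 := (F.mem_tangent_zero p v).2 (h 0)
  have h1 := (F.mem_tangent_one p v).2 (h 1)
  have := W.transversal 0 1 (by decide) (F.proj p)
  have hv : (show TangentSpace (𝓡 4) (F.proj p) from v) ∈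
    W.tangent 0 (F.proj p) ⊓ W.tangent 1 (F.proj p) := ⟨h0, h1⟩
  rw [this] at hv
  exact hv

theorem exists_covector_eq (p : P) (r : Fin 2 → Fin 2 → ℝ) :
    ∃ v, ∀ α i, F.covector α i p v = r α i := by
  set L : EuclideanSpace ℝ (Fin 4) →ₗ[ℝ] (Fin 2 → Fin 2 → ℝ) :=
    LinearMap.pi fun α => LinearMap.pi fun i => F.covector α i p with hL
  have hinj : Function.Injective L := by
    rw [← LinearMap.ker_eq_bot, LinearMap.ker_eq_bot']
    intro v hv
    exact F.eq_zero_of_covector_eq_zero p fun α i => congrFun (congrFun hv α) i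
  have hsurj : Function.Surjective L :=
    (LinearMap.injective_iff_surjective_of_finrank_eq_finrank (by simp [Module.finrank_pi_fintype])).1 hinj
  obtain ⟨v, hv⟩ := hsurj r
  exact ⟨v, fun α i => congrFun (congrFun hv α) i⟩

theorem exists_covector_change {p p' : P} (h : F.proj p = F.proj p') :
    ∃ B : Fin 2 → Fin 2 → ℝ, ∀ α i v,
      F.covector α i p' v = ∑ k, B i k * F.covector α k p v := by
  refine exists_coframe_change (F.exists_covector_eq p) ?_ ?_ ?_
  · intro v
    exact fun hv => (F.mem_tangent_zero p' v).1
      ((W.mem_tangent_congr 0 h v).1 ((F.mem_tangent_zero p v).2 hv))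
  · intro v
    exact fun hv => (F.mem_tangent_one p' v).1
      ((W.mem_tangent_congr 1 h v).1 ((F.mem_tangent_one p v).2 hv))
  · intro v
    exact fun hv => (F.mem_tangent_two p' v).1
      ((W.mem_tangent_congr 2 h v).1 ((F.mem_tangent_two p v).2 hv))

variable {F} in
theorem contraction_differential_eq_zero {conn : Fin 2 → Fin 2 → OneForm N P}
    {a : Fin 2 → P → ℝ} (hconn : F.IsConnection conn a) {e : Fin 2 → ℝ}
    (hae : ∀ p, ∑ i, e i * a i p = 0) (p : P) (v : TangentSpace (𝓡 N) p) :
    ∑ i, e i * OneForm.differential (a i) p v = 0 := by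
  have hd : ∀ i, HasMFDerivAt (𝓡 N) 𝓘(ℝ, ℝ) (a i) p (mfderiv (𝓡 N) 𝓘(ℝ, ℝ) (a i) p) :=
    fun i => ((hconn.2.1 i).mdifferentiableAt (by simp)).hasMFDerivAt
  have h1 := ((hd 0).const_smul (e 0)).add ((hd 1).const_smul (e 1))
  have h2 : e 0 • a 0 + e 1 • a 1 = fun _ => 0 := by
    funext q
    simpa [Fin.sum_univ_two] using hae q
  rw [h2] at h1
  have h3 := h1.mfderiv
  rw [mfderiv_const] at h3
  rw [Fin.sum_univ_two]
  exact (DFunLike.congr_fun h3 v).symm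

variable {F} in
/-- The connection form `c_j e_i ω_i^j` on the vectors tangent to the plane field. -/
theorem contraction_conn_eq {conn : Fin 2 → Fin 2 → OneForm N P} {a : Fin 2 → P → ℝ}
    (hconn : F.IsConnection conn a) {pd qd : Fin 2 → Fin 2 → P → ℝ}
    (hpq : F.IsPfaffianDerivative conn a pd qd) {c e : Fin 2 → ℝ} (hce : ∑ i, c i * e i = 0) {ρ : P → ℝ} (ha : ∀ i p, a i p = ρ p * c i) {p : P}
    {v : TangentSpace (𝓡 N) p} {s : Fin 2 → ℝ} (hv : ∀ α i, F.basisForm α i p v = s α * e i) :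
    -(ρ p * ∑ i, ∑ j, e i * c j * conn i j p v) =
      (∑ i, ∑ j, e i * e j * pd i j p) * s 0 + (∑ i, ∑ j, e i * e j * qd i j p) * s 1 := by
  have h := contraction_differential_eq_zero hconn (e := e) (fun q => by
    simp only [ha, Fin.sum_univ_two] at hce ⊢
    linear_combination ρ q * hce) p v
  have h0 := hpq 0 p v
  have h1 := hpq 1 p v
  simp only [ha, hv, Fin.sum_univ_two] at h h0 h1 ⊢
  linear_combination e 0 * h0 + e 1 * h1 - h

variable {F} in
-- Each torsion term is antisymmetric in two vectors proportional to the same e, hence zero; for the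
-- same reason both foliations give the same formula despite the opposite torsion signs.
theorem contraction_d_eq {conn : Fin 2 → Fin 2 → OneForm N P} {a : Fin 2 → P → ℝ}
    (hconn : F.IsConnection conn a) {c e : Fin 2 → ℝ} {p : P}
    {u v : TangentSpace (𝓡 N) p} {r s : Fin 2 → ℝ} (hu : ∀ α i, F.basisForm α i p u = r α * e i)
    (hv : ∀ α i, F.basisForm α i p v = s α * e i) (α : Fin 2) :
    ∑ i, c i * (F.basisForm α i).d p u v =
      r α * (∑ i, ∑ j, e i * c j * conn i j p v) - s α * (∑ i, ∑ j, e i * c j * conn i j p u) := by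
  fin_cases α
  · have h0 := hconn.2.2.1 0 p u v
    have h1 := hconn.2.2.1 1 p u v
    simp only [Fin.sum_univ_two, OneForm.wedge, hu, hv] at h0 h1 ⊢
    simp only [Fin.zero_eta, h0, h1]
    ring
  · have h0 := hconn.2.2.2 0 p u v
    have h1 := hconn.2.2.2 1 p u v
    simp only [Fin.sum_univ_two, OneForm.wedge, hu, hv] at h0 h1 ⊢
    simp only [Fin.mk_one, h0, h1]
    ring

end AdaptedCoframes

end Coframes

/-! ### The covector of the web at different coframes over the same point -/

section CoframeChange

open Filter Topology

variable {E : Type*} [NormedAddCommGroup E] [NormedSpace ℝ E]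

/-- The matrix is known to exist pointwise; Cramer's rule on two fixed vectors writes its entries as
quotients of differentiable functions. -/
theorem exists_differentiable_coframe_change {η η' : Fin 2 → Fin 2 → E → E →L[ℝ] ℝ} {w₀ : E}
    (hd : ∀ α i, DifferentiableAt ℝ (η α i) w₀) (hd' : ∀ α i, DifferentiableAt ℝ (η' α i) w₀)
    {e : Fin 2 → E} (he : ∀ i k, η 0 i w₀ (e k) = if i = k then 1 else 0)
    (hB : ∀ᶠ w in 𝓝 w₀, ∃ B : Fin 2 → Fin 2 → ℝ,
      ∀ α i v, η' α i w v = ∑ k, B i k * η α k w v) :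
    ∃ A : Fin 2 → Fin 2 → E → ℝ, (∀ i k, DifferentiableAt ℝ (A i k) w₀) ∧
      ∀ᶠ w in 𝓝 w₀, ∀ α i v, η' α i w v = ∑ k, A i k w * η α k w v := by
  set D : E → ℝ := fun w => η 0 0 w (e 0) * η 0 1 w (e 1) - η 0 0 w (e 1) * η 0 1 w (e 0) with hD
  have hη : ∀ α i k, DifferentiableAt ℝ (fun w => η α i w (e k)) w₀ :=
    fun α i k => (hd α i).clm_apply (differentiableAt_const _)
  have hη' : ∀ α i k, DifferentiableAt ℝ (fun w => η' α i w (e k)) w₀ :=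
    fun α i k => (hd' α i).clm_apply (differentiableAt_const _)
  have hDd : DifferentiableAt ℝ D w₀ :=
    ((hη 0 0 0).mul (hη 0 1 1)).sub ((hη 0 0 1).mul (hη 0 1 0))
  have hD0 : D w₀ ≠ 0 := by simp [hD, he]
  refine ⟨fun i k w => if k = 0 then
      (η' 0 i w (e 0) * η 0 1 w (e 1) - η' 0 i w (e 1) * η 0 1 w (e 0)) / D w
    else (η' 0 i w (e 1) * η 0 0 w (e 0) - η' 0 i w (e 0) * η 0 0 w (e 1)) / D w, ?_, ?_⟩
  · intro i k
    simp only [div_eq_mul_inv]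
    split_ifs
    · exact (((hη' 0 i 0).mul (hη 0 1 1)).sub ((hη' 0 i 1).mul (hη 0 1 0))).mul (hDd.inv hD0)
    · exact (((hη' 0 i 1).mul (hη 0 0 0)).sub ((hη' 0 i 0).mul (hη 0 0 1))).mul (hDd.inv hD0)
  · filter_upwards [hB, hDd.continuousAt.eventually_ne hD0] with w ⟨B, hBw⟩ hDw α i v
    rw [hBw α i v]
    have e0 : B i 0 = (η' 0 i w (e 0) * η 0 1 w (e 1) - η' 0 i w (e 1) * η 0 1 w (e 0)) / D w := by
      rw [eq_div_iff hDw, hBw, hBw, hD]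
      simp only [Fin.sum_univ_two]
      ring
    have e1 : B i 1 = (η' 0 i w (e 1) * η 0 0 w (e 0) - η' 0 i w (e 0) * η 0 0 w (e 1)) / D w := by
      rw [eq_div_iff hDw, hBw, hBw, hD]
      simp only [Fin.sum_univ_two]
      ring
    simp only [Fin.sum_univ_two, e0, e1]
    simp

theorem fderiv_coframe_change {η η' : Fin 2 → Fin 2 → E → E →L[ℝ] ℝ} {w₀ : E}
    (hd : ∀ α i, DifferentiableAt ℝ (η α i) w₀)
    {A : Fin 2 → Fin 2 → E → ℝ} (hA : ∀ i k, DifferentiableAt ℝ (A i k) w₀)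
    (h : ∀ᶠ w in 𝓝 w₀, ∀ α i v, η' α i w v = ∑ k, A i k w * η α k w v) (α i : Fin 2) (u v : E) :
    fderiv ℝ (η' α i) w₀ u v =
      ∑ k, (fderiv ℝ (A i k) w₀ u * η α k w₀ v + A i k w₀ * fderiv ℝ (η α k) w₀ u v) := by
  have h1 : η' α i =ᶠ[𝓝 w₀] fun w => A i 0 w • η α 0 w + A i 1 w • η α 1 w := by
    filter_upwards [h] with w hw
    ext v
    simp [hw, Fin.sum_univ_two]
  rw [h1.fderiv_eq, fderiv_fun_add ((hA i 0).fun_smul (hd α 0)) ((hA i 1).fun_smul (hd α 1)),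
    fderiv_fun_smul (hA i 0) (hd α 0), fderiv_fun_smul (hA i 1) (hd α 1)]
  simp [Fin.sum_univ_two]
  ring

/-! ### Lifts to the space of coframes and invariance of the covector -/

namespace AdaptedCoframes

variable {X : Type*} [TopologicalSpace X] [ChartedSpace (EuclideanSpace ℝ (Fin 4)) X]
variable {W : ThreeWeb X} {N : ℕ} {P : Type*} [TopologicalSpace P]
  [ChartedSpace (EuclideanSpace ℝ (Fin N)) P] (F : AdaptedCoframes W N P)

theorem contMDiff_proj : ContMDiff (𝓡 N) (𝓡 4) ∞ F.proj :=
  fun p => (F.isSubmersion.isSubmersionAt p).contMDiffAt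

theorem exists_lift [IsManifold (𝓡 4) ∞ X] [IsManifold (𝓡 N) ∞ P] {G : E → X} {w₀ : E}
    (hG : ∀ᶠ w in 𝓝 w₀, ContMDiffAt 𝓘(ℝ, E) (𝓡 4) ∞ G w) {p : P} (hp : F.proj p = G w₀) :
    ∃ σ : E → P, σ w₀ = p ∧ (∀ᶠ w in 𝓝 w₀, ContMDiffAt 𝓘(ℝ, E) (𝓡 N) ∞ σ w) ∧
      ∀ᶠ w in 𝓝 w₀, F.proj (σ w) = G w := by
  obtain ⟨s, hs0, hs, hs1⟩ := (F.isSubmersion.isSubmersionAt p).exists_local_section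
  rw [hp] at hs0 hs hs1
  have hGc := hG.self_of_nhds.continuousAt
  refine ⟨fun w => s (G w), hs0, ?_, hGc.eventually hs1⟩
  filter_upwards [hG, hGc.eventually hs] with w h1 h2
  exact h2.comp w h1

/-- The basis forms are semibasic, so along a lift σ of G they see only the coframe at σ w and the
differential of G. -/
theorem pullback_basisForm {σ : E → P} {G : E → X} {w : E}
    (hσ : ContMDiffAt 𝓘(ℝ, E) (𝓡 N) ∞ σ w) (hG : ∀ᶠ z in 𝓝 w, F.proj (σ z) = G z)
    (α i : Fin 2) (v : E) :
    OneForm.pullback σ (F.basisForm α i) w v =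
      F.covector α i (σ w) (mfderiv 𝓘(ℝ, E) (𝓡 4) G w v) := by
  have h1 : F.proj ∘ σ =ᶠ[𝓝 w] G := hG
  have h2 := mfderiv_comp w (F.contMDiff_proj.mdifferentiableAt (by simp) (x := σ w))
    (hσ.mdifferentiableAt (by simp))
  rw [← h1.mfderiv_eq, h2]
  rfl

theorem d_basisForm_pullback [IsManifold (𝓡 N) ∞ P] {σ : E → P} {w : E}
    (hσ : ContMDiffAt 𝓘(ℝ, E) (𝓡 N) ∞ σ w) (α i : Fin 2) (u v : E) :
    fderiv ℝ (OneForm.pullback σ (F.basisForm α i)) w u v -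
      fderiv ℝ (OneForm.pullback σ (F.basisForm α i)) w v u =
      (F.basisForm α i).d (σ w) (mfderiv 𝓘(ℝ, E) (𝓡 N) σ w u) (mfderiv 𝓘(ℝ, E) (𝓡 N) σ w v) :=
  OneForm.d_pullback hσ (F.smooth α i) u v

variable {F} in
theorem structure_equation_zero_pullback [IsManifold (𝓡 N) ∞ P]
    {conn : Fin 2 → Fin 2 → OneForm N P} {a : Fin 2 → P → ℝ} (hconn : F.IsConnection conn a)
    {σ : E → P} {w : E} (hσ : ContMDiffAt 𝓘(ℝ, E) (𝓡 N) ∞ σ w) (i : Fin 2) (u v : E) :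
    fderiv ℝ (OneForm.pullback σ (F.basisForm 0 i)) w u v -
      fderiv ℝ (OneForm.pullback σ (F.basisForm 0 i)) w v u =
    ∑ j, (OneForm.pullback σ (F.basisForm 0 j) w u * OneForm.pullback σ (conn j i) w v -
        OneForm.pullback σ (F.basisForm 0 j) w v * OneForm.pullback σ (conn j i) w u) +
      ∑ j, a j (σ w) *
        (OneForm.pullback σ (F.basisForm 0 j) w u * OneForm.pullback σ (F.basisForm 0 i) w v -
          OneForm.pullback σ (F.basisForm 0 j) w v * OneForm.pullback σ (F.basisForm 0 i) w u) :=
  (F.d_basisForm_pullback hσ 0 i u v).trans (hconn.2.2.1 i _ _ _)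

variable {F} in
theorem structure_equation_one_pullback [IsManifold (𝓡 N) ∞ P]
    {conn : Fin 2 → Fin 2 → OneForm N P} {a : Fin 2 → P → ℝ} (hconn : F.IsConnection conn a)
    {σ : E → P} {w : E} (hσ : ContMDiffAt 𝓘(ℝ, E) (𝓡 N) ∞ σ w) (i : Fin 2) (u v : E) :
    fderiv ℝ (OneForm.pullback σ (F.basisForm 1 i)) w u v -
      fderiv ℝ (OneForm.pullback σ (F.basisForm 1 i)) w v u =
    ∑ j, (OneForm.pullback σ (F.basisForm 1 j) w u * OneForm.pullback σ (conn j i) w v -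
        OneForm.pullback σ (F.basisForm 1 j) w v * OneForm.pullback σ (conn j i) w u) -
      ∑ j, a j (σ w) *
        (OneForm.pullback σ (F.basisForm 1 j) w u * OneForm.pullback σ (F.basisForm 1 i) w v -
          OneForm.pullback σ (F.basisForm 1 j) w v * OneForm.pullback σ (F.basisForm 1 i) w u) :=
  (F.d_basisForm_pullback hσ 1 i u v).trans (hconn.2.2.2 i _ _ _)

variable {F} in
-- Two lifts of one map G give two coframes related by a differentiable matrix A. Differentiating
-- that relation and inserting both sets of structure equations gives the hypotheses of
-- `covector_transformation`.
theorem torsionCovector_eq_of_lifts [IsManifold (𝓡 N) ∞ P]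
    {conn : Fin 2 → Fin 2 → OneForm N P} {a : Fin 2 → P → ℝ} (hconn : F.IsConnection conn a)
    {G : E → X} {σ σ' : E → P} {w₀ : E}
    (hσ : ∀ᶠ w in 𝓝 w₀, ContMDiffAt 𝓘(ℝ, E) (𝓡 N) ∞ σ w)
    (hσ' : ∀ᶠ w in 𝓝 w₀, ContMDiffAt 𝓘(ℝ, E) (𝓡 N) ∞ σ' w)
    (hG : ∀ᶠ w in 𝓝 w₀, F.proj (σ w) = G w) (hG' : ∀ᶠ w in 𝓝 w₀, F.proj (σ' w) = G w)
    (hsurj : Function.Surjective (mfderiv 𝓘(ℝ, E) (𝓡 4) G w₀))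
    (α : Fin 2) (v : EuclideanSpace ℝ (Fin 4)) :
    ∑ i, a i (σ w₀) * F.covector α i (σ w₀) v = ∑ i, a i (σ' w₀) * F.covector α i (σ' w₀) v := by
  set η : Fin 2 → Fin 2 → E → E →L[ℝ] ℝ := fun α i => OneForm.pullback σ (F.basisForm α i) with hη
  set η' : Fin 2 → Fin 2 → E → E →L[ℝ] ℝ :=
    fun α i => OneForm.pullback σ' (F.basisForm α i) with hη'
  have hd : ∀ α i, DifferentiableAt ℝ (η α i) w₀ := fun α i =>
    (OneForm.contDiffAt_pullback hσ.self_of_nhds (F.smooth α i)).differentiableAt (by simp)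
  have hd' : ∀ α i, DifferentiableAt ℝ (η' α i) w₀ := fun α i =>
    (OneForm.contDiffAt_pullback hσ'.self_of_nhds (F.smooth α i)).differentiableAt (by simp)
  have hθ : ∀ᶠ w in 𝓝 w₀, ∀ α i v,
      η α i w v = F.covector α i (σ w) (mfderiv 𝓘(ℝ, E) (𝓡 4) G w v) := by
    filter_upwards [hσ, hG.eventually_nhds] with w h1 h2 α i v
    exact F.pullback_basisForm h1 h2 α i v
  have hθ' : ∀ᶠ w in 𝓝 w₀, ∀ α i v,
      η' α i w v = F.covector α i (σ' w) (mfderiv 𝓘(ℝ, E) (𝓡 4) G w v) := by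
    filter_upwards [hσ', hG'.eventually_nhds] with w h1 h2 α i v
    exact F.pullback_basisForm h1 h2 α i v
  have hB : ∀ᶠ w in 𝓝 w₀, ∃ B : Fin 2 → Fin 2 → ℝ,
      ∀ α i v, η' α i w v = ∑ k, B i k * η α k w v := by
    filter_upwards [hθ, hθ', hG, hG'] with w h1 h2 h3 h4
    obtain ⟨B, hB⟩ := F.exists_covector_change (h3.trans h4.symm)
    refine ⟨B, fun α i v => ?_⟩
    simp only [h1, h2]
    exact hB α i _
  have hdual : ∀ r : Fin 2 → Fin 2 → ℝ, ∃ v : E, ∀ α i, η α i w₀ v = r α i := by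
    intro r
    obtain ⟨v, hv⟩ := F.exists_covector_eq (σ w₀) r
    obtain ⟨u, hu⟩ := hsurj v
    exact ⟨u, fun α i => (hθ.self_of_nhds α i u).trans
      ((congrArg (F.covector α i (σ w₀)) hu).trans (hv α i))⟩
  have hdual' : ∀ r : Fin 2 → Fin 2 → ℝ, ∃ v : E, ∀ α i, η' α i w₀ v = r α i := by
    intro r
    obtain ⟨v, hv⟩ := F.exists_covector_eq (σ' w₀) r
    obtain ⟨u, hu⟩ := hsurj v
    exact ⟨u, fun α i => (hθ'.self_of_nhds α i u).trans
      ((congrArg (F.covector α i (σ' w₀)) hu).trans (hv α i))⟩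
  choose e he using fun (β k : Fin 2) => hdual fun α i => if α = β ∧ i = k then 1 else 0
  obtain ⟨A, hAd, hA⟩ := exists_differentiable_coframe_change hd hd' (e := e 0)
    (fun i k => by simp [he]) hB
  have hA0 := hA.self_of_nhds
  -- The determinant of A times that of η on (x, y) is the determinant of η' on (x, y), which is 1.
  have hdet : A 0 0 w₀ * A 1 1 w₀ - A 0 1 w₀ * A 1 0 w₀ ≠ 0 := by
    obtain ⟨x, hx⟩ := hdual' fun α i => if i = 0 then 1 else 0
    obtain ⟨y, hy⟩ := hdual' fun α i => if i = 1 then 1 else 0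
    have x0 := (hA0 0 0 x).symm.trans (hx 0 0)
    have x1 := (hA0 0 1 x).symm.trans (hx 0 1)
    have y0 := (hA0 0 0 y).symm.trans (hy 0 0)
    have y1 := (hA0 0 1 y).symm.trans (hy 0 1)
    simp [Fin.sum_univ_two] at x0 x1 y0 y1
    intro h0
    have : (1 : ℝ) = 0 := by
      linear_combination (η 0 0 w₀ x * η 0 1 w₀ y - η 0 1 w₀ x * η 0 0 w₀ y) * h0 -
        x0 * (A 1 0 w₀ * η 0 0 w₀ y + A 1 1 w₀ * η 0 1 w₀ y) - y1 +
        x1 * (A 0 0 w₀ * η 0 0 w₀ y + A 0 1 w₀ * η 0 1 w₀ y)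
    exact one_ne_zero this
  have hf := fderiv_coframe_change hd hAd hA
  have key := covector_transformation (V := E) (η := fun α i => η α i w₀)
    (η' := fun α i => η' α i w₀)
    (κ := fun j i => OneForm.pullback σ (conn j i) w₀)
    (κ' := fun j i => OneForm.pullback σ' (conn j i) w₀)
    (dA := fun i k => fderiv ℝ (A i k) w₀)
    (a := fun i => a i (σ w₀)) (a' := fun i => a i (σ' w₀)) (A := fun i k => A i k w₀) (e := e)
    (fun α i β k => he β k α i) hA0 hdet ?_ ?_
  · obtain ⟨u, hu⟩ : ∃ u : E, mfderiv 𝓘(ℝ, E) (𝓡 4) G w₀ u = v := hsurj v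
    have c0 : ∀ i, F.covector α i (σ w₀) v = η α i w₀ u := fun i =>
      ((hθ.self_of_nhds α i u).trans (congrArg (F.covector α i (σ w₀)) hu)).symm
    have c1 : ∀ i, F.covector α i (σ' w₀) v = η' α i w₀ u := fun i =>
      ((hθ'.self_of_nhds α i u).trans (congrArg (F.covector α i (σ' w₀)) hu)).symm
    simp only [Fin.sum_univ_two] at key hA0 ⊢
    rw [c0, c0, c1, c1, hA0, hA0, key, key]
    ring
  · intro i u v
    have s' := structure_equation_zero_pullback hconn hσ'.self_of_nhds i u v
    have s0 := structure_equation_zero_pullback hconn hσ.self_of_nhds 0 u v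
    have s1 := structure_equation_zero_pullback hconn hσ.self_of_nhds 1 u v
    have f1 := hf 0 i u v
    have f2 := hf 0 i v u
    simp only [Fin.sum_univ_two] at s' s0 s1 f1 f2 ⊢
    -- The product rule antisymmetrized in u and v, with the structure equations of both lifts
    -- substituted.
    linear_combination f1 - f2 - s' + A i 0 w₀ * s0 + A i 1 w₀ * s1
  · intro i u v
    have s' := structure_equation_one_pullback hconn hσ'.self_of_nhds i u v
    have s0 := structure_equation_one_pullback hconn hσ.self_of_nhds 0 u v
    have s1 := structure_equation_one_pullback hconn hσ.self_of_nhds 1 u v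
    have f1 := hf 1 i u v
    have f2 := hf 1 i v u
    simp only [Fin.sum_univ_two] at s' s0 s1 f1 f2 ⊢
    linear_combination f1 - f2 - s' + A i 0 w₀ * s0 + A i 1 w₀ * s1

variable {F} in
theorem torsionCovector_eq [IsManifold (𝓡 4) ∞ X] [IsManifold (𝓡 N) ∞ P]
    {conn : Fin 2 → Fin 2 → OneForm N P} {a : Fin 2 → P → ℝ} (hconn : F.IsConnection conn a)
    {p p' : P} (h : F.proj p = F.proj p') (α : Fin 2) (v : EuclideanSpace ℝ (Fin 4)) :
    ∑ i, a i p * F.covector α i p v = ∑ i, a i p' * F.covector α i p' v := by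
  set κ := extChartAt (𝓡 4) (F.proj p)
  have hκ : κ.symm (κ (F.proj p)) = F.proj p := κ.left_inv (mem_extChartAt_source _)
  have hG : ∀ᶠ z in 𝓝 (κ (F.proj p)),
      ContMDiffAt 𝓘(ℝ, EuclideanSpace ℝ (Fin 4)) (𝓡 4) ∞ κ.symm z := by
    filter_upwards [eventually_mem_nhds_iff.2 (extChartAt_target_mem_nhds (F.proj p))] with z hz
    exact (contMDiffOn_extChartAt_symm _).contMDiffAt hz
  obtain ⟨σ, hσ0, hσ, hσG⟩ := F.exists_lift hG hκ.symm
  obtain ⟨σ', hσ0', hσ', hσG'⟩ := F.exists_lift hG (h.symm.trans hκ.symm)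
  have hinv : (mfderiv 𝓘(ℝ, EuclideanSpace ℝ (Fin 4)) (𝓡 4) κ.symm
      (κ (F.proj p))).IsInvertible := by
    have := isInvertible_mfderivWithin_extChartAt_symm (I := 𝓡 4) (mem_extChartAt_target (F.proj p))
    rwa [ModelWithCorners.range_eq_univ, mfderivWithin_univ] at this
  have := torsionCovector_eq_of_lifts hconn hσ hσ' hσG hσG' hinv.bijective.2 α v
  rwa [hσ0, hσ0'] at this

end AdaptedCoframes

end CoframeChange

/-! ### Integral surfaces annihilate the obstruction; product charts of a web -/

section Necessity

open Filter Topology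

variable {X : Type*} [TopologicalSpace X] [ChartedSpace (EuclideanSpace ℝ (Fin 4)) X]
  [IsManifold (𝓡 4) ∞ X] {W : ThreeWeb X} {N : ℕ} {P : Type*} [TopologicalSpace P]
  [ChartedSpace (EuclideanSpace ℝ (Fin N)) P] [IsManifold (𝓡 N) ∞ P]
  {F : AdaptedCoframes W N P}

namespace AdaptedCoframes

/-- If `a` is proportional to `c`, the `a`-distribution is given by the equations
`c₁ ω_α¹ + c₂ ω_α² = 0`. -/
theorem mem_aDistribution_iff {conn : Fin 2 → Fin 2 → OneForm N P} {a : Fin 2 → P → ℝ}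
    (hconn : F.IsConnection conn a) {c : Fin 2 → ℝ} {ρ : P → ℝ} (ha : ∀ i p, a i p = ρ p * c i)
    (hρ : ∀ p, ρ p ≠ 0) {p : P} {x : X} (hp : F.proj p = x) (v : TangentSpace (𝓡 4) x) :
    v ∈ F.aDistribution a x ↔ ∀ α, ∑ i, c i * F.covector α i p v = 0 := by
  have h1 : ∀ α, ∑ i, a i p * F.covector α i p v = ρ p * ∑ i, c i * F.covector α i p v := by
    intro α
    rw [Finset.mul_sum]
    exact Finset.sum_congr rfl fun i _ => by rw [ha, mul_assoc]
  rw [F.mem_aDistribution]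
  constructor
  · intro h α
    have := h p hp α
    rw [h1] at this
    exact (mul_eq_zero.1 this).resolve_left (hρ p)
  · intro h p' hp' α
    refine (torsionCovector_eq hconn (hp'.trans hp.symm) α v).trans ?_
    rw [h1, h α, mul_zero]

theorem obstruction_eq_zero_of_isIntegrable {conn : Fin 2 → Fin 2 → OneForm N P}
    {a : Fin 2 → P → ℝ} (hconn : F.IsConnection conn a) {pd qd : Fin 2 → Fin 2 → P → ℝ}
    (hpq : F.IsPfaffianDerivative conn a pd qd) {c e : Fin 2 → ℝ} (hce : ∑ i, c i * e i = 0)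
    {ρ : P → ℝ} (ha : ∀ i p, a i p = ρ p * c i) (hρ : ∀ p, ρ p ≠ 0)
    (hint : IsIntegrable (F.aDistribution a)) (p : P) :
    (∑ i, ∑ j, e i * e j * pd i j p = 0) ∧ (∑ i, ∑ j, e i * e j * qd i j p = 0) := by
  obtain ⟨U, φ, hU, h0U, hφ0, hφ, hφt⟩ := hint (F.proj p)
  have hG : ∀ᶠ w in 𝓝 (0 : EuclideanSpace ℝ (Fin 2)), ContMDiffAt (𝓡 2) (𝓡 4) ∞ φ w := by
    filter_upwards [hU.mem_nhds h0U] with w hw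
    exact hφ.contMDiffAt (hU.mem_nhds hw)
  obtain ⟨σ, hσ0, hσ, hσG⟩ := F.exists_lift hG hφ0.symm
  rw [← hσ0]
  set η : Fin 2 → Fin 2 → EuclideanSpace ℝ (Fin 2) → EuclideanSpace ℝ (Fin 2) →L[ℝ] ℝ :=
    fun α i => OneForm.pullback σ (F.basisForm α i) with hη
  have hd : ∀ α i, DifferentiableAt ℝ (η α i) 0 := fun α i =>
    (OneForm.contDiffAt_pullback hσ.self_of_nhds (F.smooth α i)).differentiableAt (by simp)
  have hθ : ∀ᶠ w in 𝓝 (0 : EuclideanSpace ℝ (Fin 2)), ∀ α i v,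
      η α i w v = F.covector α i (σ w) (mfderiv (𝓡 2) (𝓡 4) φ w v) := by
    filter_upwards [hσ, hσG.eventually_nhds] with w h1 h2 α i v
    exact F.pullback_basisForm h1 h2 α i v
  have hzero : ∀ α, (fun w => c 0 • η α 0 w + c 1 • η α 1 w) =ᶠ[𝓝 0] fun _ => 0 := by
    intro α
    filter_upwards [hθ, hσG, hU.mem_nhds h0U] with w h1 h2 h3
    ext v
    have hmem : mfderiv (𝓡 2) (𝓡 4) φ w v ∈ F.aDistribution a (φ w) := by
      rw [← (hφt w h3).2]
      exact ⟨v, rfl⟩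
    have := (mem_aDistribution_iff hconn ha hρ h2 _).1 hmem α
    rw [Fin.sum_univ_two] at this
    simpa [h1] using this
  have hdzero : ∀ α u v, ∑ i, c i * fderiv ℝ (η α i) 0 u v = 0 := by
    intro α u v
    have h1 := (((hd α 0).hasFDerivAt.fun_const_smul (c 0)).fun_add
      ((hd α 1).hasFDerivAt.fun_const_smul (c 1))).fderiv
    rw [(hzero α).fderiv_eq, fderiv_fun_const] at h1
    have h2 := DFunLike.congr_fun (DFunLike.congr_fun h1 u) v
    simpa [Fin.sum_univ_two] using h2.symm
  have hframe : ∀ r : Fin 2 → ℝ, ∃ u : EuclideanSpace ℝ (Fin 2), ∀ α i,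
      F.basisForm α i (σ 0) (mfderiv (𝓡 2) (𝓡 N) σ 0 u) = r α * e i := by
    intro r
    obtain ⟨V, hV⟩ := F.exists_covector_eq (σ 0) fun α i => r α * e i
    have hmem : Membership.mem (F.aDistribution a (φ 0)) V := by
      refine (mem_aDistribution_iff hconn ha hρ hσG.self_of_nhds V).2 fun α => ?_
      simp only [hV, Fin.sum_univ_two] at hce ⊢
      linear_combination r α * hce
    rw [← (hφt 0 h0U).2] at hmem
    obtain ⟨u, hu⟩ := hmem
    exact ⟨u, fun α i => (hθ.self_of_nhds α i u).trans
      ((congrArg (F.covector α i (σ 0)) hu).trans (hV α i))⟩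
  -- Basis of Δ adapted to the web: u has ω₁ = e, ω₂ = 0 and v has ω₁ = 0, ω₂ = e. Then α = 1 and α
  -- = 2 yield τ(v) = 0 and τ(u) = 0 separately.
  obtain ⟨u, hu⟩ := hframe ![1, 0]
  obtain ⟨v, hv⟩ := hframe ![0, 1]
  have hdd : ∀ α, ∑ i, c i * (F.basisForm α i).d (σ 0) (mfderiv (𝓡 2) (𝓡 N) σ 0 u)
      (mfderiv (𝓡 2) (𝓡 N) σ 0 v) = 0 := by
    intro α
    have h1 := hdzero α u v
    have h2 := hdzero α v u
    simp only [← F.d_basisForm_pullback hσ.self_of_nhds]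
    simp only [Fin.sum_univ_two] at h1 h2 ⊢
    linear_combination h1 - h2
  have k0 := (contraction_d_eq hconn hu hv 0).symm.trans (hdd 0)
  have k1 := (contraction_d_eq hconn hu hv 1).symm.trans (hdd 1)
  have c0 := contraction_conn_eq hconn hpq hce ha hu
  have c1 := contraction_conn_eq hconn hpq hce ha hv
  simp only [Matrix.cons_val_zero, Matrix.cons_val_one, one_mul, zero_mul, sub_zero, zero_sub,
    mul_one, mul_zero, add_zero, zero_add, neg_eq_zero] at k0 k1 c0 c1
  rw [k1, mul_zero, neg_zero] at c0
  rw [k0, mul_zero, neg_zero] at c1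
  exact ⟨c0.symm, c1.symm⟩

end AdaptedCoframes

theorem mfderiv_clm_comp {n : ℕ} {M : Type*} [TopologicalSpace M]
    [ChartedSpace (EuclideanSpace ℝ (Fin n)) M] {F F' : Type*} [NormedAddCommGroup F]
    [NormedSpace ℝ F] [NormedAddCommGroup F'] [NormedSpace ℝ F'] (L : F →L[ℝ] F') {f : M → F}
    {y : M} (hf : MDifferentiableAt (𝓡 n) 𝓘(ℝ, F) f y) (v : TangentSpace (𝓡 n) y) :
    mfderiv (𝓡 n) 𝓘(ℝ, F') (fun z => L (f z)) y v = L (mfderiv (𝓡 n) 𝓘(ℝ, F) f y v) := by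
  have := mfderiv_comp y (L.mdifferentiableAt (x := f y)) hf
  rw [L.mfderiv_eq] at this
  exact DFunLike.congr_fun this v

/-- Near every point, the first two foliations of a web are the factors of a product. -/
theorem ThreeWeb.exists_product_chart (W : ThreeWeb X) (x : X) :
    ∃ (w₀ : EuclideanSpace ℝ (Fin 2) × EuclideanSpace ℝ (Fin 2))
      (G : EuclideanSpace ℝ (Fin 2) × EuclideanSpace ℝ (Fin 2) → X), G w₀ = x ∧
      ∀ᶠ w in 𝓝 w₀,
        ContMDiffAt 𝓘(ℝ, EuclideanSpace ℝ (Fin 2) × EuclideanSpace ℝ (Fin 2)) (𝓡 4) ∞ G w ∧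
        Function.Bijective
          (mfderiv 𝓘(ℝ, EuclideanSpace ℝ (Fin 2) × EuclideanSpace ℝ (Fin 2)) (𝓡 4) G w) ∧
        (∀ v : EuclideanSpace ℝ (Fin 2),
          mfderiv 𝓘(ℝ, EuclideanSpace ℝ (Fin 2) × EuclideanSpace ℝ (Fin 2)) (𝓡 4) G w
            ((0 : EuclideanSpace ℝ (Fin 2)), v) ∈ W.tangent 0 (G w)) ∧
        (∀ u : EuclideanSpace ℝ (Fin 2),
          mfderiv 𝓘(ℝ, EuclideanSpace ℝ (Fin 2) × EuclideanSpace ℝ (Fin 2)) (𝓡 4) G w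
            (u, (0 : EuclideanSpace ℝ (Fin 2))) ∈ W.tangent 1 (G w)) := by
  obtain ⟨U₀, f₀, hU₀, hx₀, hf₀, ht₀⟩ := W.isFoliation 0 x
  obtain ⟨U₁, f₁, hU₁, hx₁, hf₁, ht₁⟩ := W.isFoliation 1 x
  -- The local first integrals of the two foliations serve together as coordinates; transversality
  -- makes the differential injective.
  set f : X → EuclideanSpace ℝ (Fin 2) × EuclideanSpace ℝ (Fin 2) := fun y => (f₀ y, f₁ y) with hf
  have hfs : ∀ y ∈ U₀ ∩ U₁, ContMDiffAt (𝓡 4)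
      𝓘(ℝ, EuclideanSpace ℝ (Fin 2) × EuclideanSpace ℝ (Fin 2)) ∞ f y := fun y hy =>
    (hf₀.contMDiffAt (hU₀.mem_nhds hy.1)).prodMk_space (hf₁.contMDiffAt (hU₁.mem_nhds hy.2))
  have hUx : U₀ ∩ U₁ ∈ 𝓝 x := (hU₀.inter hU₁).mem_nhds ⟨hx₀, hx₁⟩
  have hfst : ∀ y ∈ U₀ ∩ U₁, ∀ v : TangentSpace (𝓡 4) y,
      (mfderiv (𝓡 4) 𝓘(ℝ, EuclideanSpace ℝ (Fin 2) × EuclideanSpace ℝ (Fin 2)) f y v).1 =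
        mfderiv (𝓡 4) (𝓡 2) f₀ y v := fun y hy v =>
    (mfderiv_clm_comp (ContinuousLinearMap.fst ℝ _ _) ((hfs y hy).mdifferentiableAt (by simp))
      v).symm
  have hsnd : ∀ y ∈ U₀ ∩ U₁, ∀ v : TangentSpace (𝓡 4) y,
      (mfderiv (𝓡 4) 𝓘(ℝ, EuclideanSpace ℝ (Fin 2) × EuclideanSpace ℝ (Fin 2)) f y v).2 =
        mfderiv (𝓡 4) (𝓡 2) f₁ y v := fun y hy v =>
    (mfderiv_clm_comp (ContinuousLinearMap.snd ℝ _ _) ((hfs y hy).mdifferentiableAt (by simp))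
      v).symm
  have hdim : Module.finrank ℝ (EuclideanSpace ℝ (Fin 4)) =
      Module.finrank ℝ (EuclideanSpace ℝ (Fin 2) × EuclideanSpace ℝ (Fin 2)) := by simp
  have hinj : Function.Injective
      (mfderiv (𝓡 4) 𝓘(ℝ, EuclideanSpace ℝ (Fin 2) × EuclideanSpace ℝ (Fin 2)) f x) := by
    rw [injective_iff_map_eq_zero]
    intro v hv
    have h0 : v ∈ W.tangent 0 x := by
      rw [(ht₀ x hx₀).2, LinearMap.mem_ker]
      exact (hfst x ⟨hx₀, hx₁⟩ v).symm.trans (by rw [hv]; rfl)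
    have h1 : v ∈ W.tangent 1 x := by
      rw [(ht₁ x hx₁).2, LinearMap.mem_ker]
      exact (hsnd x ⟨hx₀, hx₁⟩ v).symm.trans (by rw [hv]; rfl)
    have : v ∈ W.tangent 0 x ⊓ W.tangent 1 x := ⟨h0, h1⟩
    rw [W.transversal 0 1 (by decide)] at this
    exact this
  have hbij : Function.Bijective
      (mfderiv (𝓡 4) 𝓘(ℝ, EuclideanSpace ℝ (Fin 2) × EuclideanSpace ℝ (Fin 2)) f x) :=
    ⟨hinj, (LinearMap.injective_iff_surjective_of_finrank_eq_finrank (V := EuclideanSpace ℝ (Fin 4))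
      (V₂ := EuclideanSpace ℝ (Fin 2) × EuclideanSpace ℝ (Fin 2)) hdim
      (f := (mfderiv (𝓡 4) 𝓘(ℝ, EuclideanSpace ℝ (Fin 2) × EuclideanSpace ℝ (Fin 2)) f
        x).toLinearMap)).1 hinj⟩
  obtain ⟨G, hG0, hG, hGf⟩ := exists_local_inverse
    (eventually_of_mem hUx fun y hy => hfs y hy) hbij
  have hGc := hG.self_of_nhds.continuousAt
  rw [ContinuousAt, hG0] at hGc
  refine ⟨f x, G, hG0, ?_⟩
  filter_upwards [hG, hGf.eventually_nhds, hGc.eventually hUx] with w h1 h2 h3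
  have hid : ∀ v : EuclideanSpace ℝ (Fin 2) × EuclideanSpace ℝ (Fin 2),
      mfderiv (𝓡 4) 𝓘(ℝ, EuclideanSpace ℝ (Fin 2) × EuclideanSpace ℝ (Fin 2)) f (G w)
        (mfderiv 𝓘(ℝ, EuclideanSpace ℝ (Fin 2) × EuclideanSpace ℝ (Fin 2)) (𝓡 4) G w v) = v := by
    intro v
    have hc := mfderiv_comp w ((hfs _ h3).mdifferentiableAt (by simp))
      (h1.mdifferentiableAt (by simp))
    have he : f ∘ G =ᶠ[𝓝 w] id := h2
    rw [he.mfderiv_eq, mfderiv_id] at hc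
    exact (DFunLike.congr_fun hc v).symm
  have hinjG : Function.Injective
      (mfderiv 𝓘(ℝ, EuclideanSpace ℝ (Fin 2) × EuclideanSpace ℝ (Fin 2)) (𝓡 4) G w) :=
    Function.LeftInverse.injective (g := mfderiv (𝓡 4)
      𝓘(ℝ, EuclideanSpace ℝ (Fin 2) × EuclideanSpace ℝ (Fin 2)) f (G w)) hid
  refine ⟨h1, ⟨hinjG, (LinearMap.injective_iff_surjective_of_finrank_eq_finrank
    (V := EuclideanSpace ℝ (Fin 2) × EuclideanSpace ℝ (Fin 2)) (V₂ := EuclideanSpace ℝ (Fin 4))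
    hdim.symm (f := (mfderiv 𝓘(ℝ, EuclideanSpace ℝ (Fin 2) × EuclideanSpace ℝ (Fin 2)) (𝓡 4) G
      w).toLinearMap)).1 hinjG⟩, fun v => ?_, fun u => ?_⟩
  · rw [(ht₀ _ h3.1).2, LinearMap.mem_ker]
    exact (hfst _ h3 _).symm.trans (by rw [hid]; rfl)
  · rw [(ht₁ _ h3.2).2, LinearMap.mem_ker]
    exact (hsnd _ h3 _).symm.trans (by rw [hid]; rfl)

end Necessity

/-! ### Construction of integral surfaces -/

section Sufficiency

open Filter Topology Set

/-- Differentiating ζ(a + γb) = 0 along B gives (D_B ζ)(a + γb) + (D_B γ) ζ(b) = 0. -/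
theorem fderiv_slope_eq_zero {E : Type*} [NormedAddCommGroup E] [NormedSpace ℝ E]
    {ζ : E → E →L[ℝ] ℝ} {w a b B : E} {γ : E → ℝ} (hζ : DifferentiableAt ℝ ζ w)
    (hγ : DifferentiableAt ℝ γ w) (h : ∀ᶠ z in 𝓝 w, ζ z (a + γ z • b) = 0) (hb : ζ w b ≠ 0)
    (hB : fderiv ℝ ζ w B (a + γ w • b) = 0) : fderiv ℝ γ w B = 0 := by
  have h1 := hζ.hasFDerivAt.clm_apply ((hγ.hasFDerivAt.smul_const b).const_add a)
  have h2 : (fun z => ζ z (a + γ z • b)) =ᶠ[𝓝 w] fun _ => 0 := h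
  have h3 := h1.fderiv
  rw [h2.fderiv_eq, fderiv_fun_const] at h3
  have h4 := DFunLike.congr_fun h3 B
  simp [-map_add, hB] at h4
  exact h4.resolve_right hb

/-- Frobenius' theorem for a plane field on a product `Y × Z` which is the sum of a line field along
`Y` and a line field along `Z`: the integral surfaces are products of curves. -/
theorem exists_product_integral_surface_of_forms {Y Z : Type*} [NormedAddCommGroup Y]
    [NormedSpace ℝ Y] [CompleteSpace Y] [NormedAddCommGroup Z] [NormedSpace ℝ Z] [CompleteSpace Z]
    {ζ : Fin 2 → Y × Z → Y × Z →L[ℝ] ℝ} {w₀ : Y × Z} {u₁ u₂ : Y} {v₁ v₂ : Z}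
    (hζ : ∀ α, ∀ᶠ w in 𝓝 w₀, ContDiffAt ℝ ∞ (ζ α) w)
    (h0 : ∀ᶠ w in 𝓝 w₀, ∀ z, ζ 0 w (0, z) = 0) (h1 : ∀ᶠ w in 𝓝 w₀, ∀ y, ζ 1 w (y, 0) = 0)
    (hF : ∀ᶠ w in 𝓝 w₀, ∀ U V, (∀ α, ζ α w U = 0) → (∀ α, ζ α w V = 0) →
      ∀ α, fderiv ℝ (ζ α) w U V = fderiv ℝ (ζ α) w V U)
    (hu : ζ 0 w₀ (u₂, 0) ≠ 0) (hv : ζ 1 w₀ (0, v₂) ≠ 0) :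
    ∃ (γ β : Y × Z → ℝ) (y : ℝ → Y) (z : ℝ → Z) (ε : ℝ), 0 < ε ∧ (y 0, z 0) = w₀ ∧
      (∀ᶠ w in 𝓝 w₀, ζ 0 w (u₁ + γ w • u₂, 0) = 0 ∧ ζ 1 w (0, v₁ + β w • v₂) = 0) ∧
      ∀ t ∈ Ioo (-ε) ε, ∀ s ∈ Ioo (-ε) ε, ContDiffAt ℝ ∞ y t ∧ ContDiffAt ℝ ∞ z s ∧
        HasDerivAt y (u₁ + γ (y t, z s) • u₂) t ∧ HasDerivAt z (v₁ + β (y t, z s) • v₂) s := by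
  set γ : Y × Z → ℝ := fun w => -ζ 0 w (u₁, 0) / ζ 0 w (u₂, 0) with hγ
  set β : Y × Z → ℝ := fun w => -ζ 1 w (0, v₁) / ζ 1 w (0, v₂) with hβ
  have hu' : ∀ᶠ w in 𝓝 w₀, ζ 0 w (u₂, 0) ≠ 0 :=
    ((hζ 0).self_of_nhds.continuousAt.clm_apply continuousAt_const).eventually_ne hu
  have hv' : ∀ᶠ w in 𝓝 w₀, ζ 1 w (0, v₂) ≠ 0 :=
    ((hζ 1).self_of_nhds.continuousAt.clm_apply continuousAt_const).eventually_ne hv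
  have hγs : ∀ᶠ w in 𝓝 w₀, ContDiffAt ℝ ∞ γ w := by
    filter_upwards [hζ 0, hu'] with w hw hw'
    exact ((hw.clm_apply contDiffAt_const).neg).div (hw.clm_apply contDiffAt_const) hw'
  have hβs : ∀ᶠ w in 𝓝 w₀, ContDiffAt ℝ ∞ β w := by
    filter_upwards [hζ 1, hv'] with w hw hw'
    exact ((hw.clm_apply contDiffAt_const).neg).div (hw.clm_apply contDiffAt_const) hw'
  have hγe : ∀ w, ((u₁ + γ w • u₂, 0) : Y × Z) = (u₁, 0) + γ w • (u₂, 0) := fun w => by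
    ext <;> simp
  have hβe : ∀ w, ((0, v₁ + β w • v₂) : Y × Z) = (0, v₁) + β w • (0, v₂) := fun w => by
    ext <;> simp
  have hγ0 : ∀ᶠ w in 𝓝 w₀, ζ 0 w ((u₁, 0) + γ w • (u₂, 0)) = 0 := by
    filter_upwards [hu'] with w hw
    rw [map_add, map_smul, smul_eq_mul]
    simp only [hγ]
    field_simp
    ring
  have hβ0 : ∀ᶠ w in 𝓝 w₀, ζ 1 w ((0, v₁) + β w • (0, v₂)) = 0 := by
    filter_upwards [hv'] with w hw
    rw [map_add, map_smul, smul_eq_mul]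
    simp only [hβ]
    field_simp
    ring
  have hd0 : ∀ᶠ w in 𝓝 w₀, ∀ C z, fderiv ℝ (ζ 0) w C (0, z) = 0 := by
    filter_upwards [h0.eventually_nhds, hζ 0] with w hw hs C z
    have e1 : (fun w => ζ 0 w (0, z)) =ᶠ[𝓝 w] fun _ => 0 := hw.mono fun _ h => h z
    have e2 := e1.fderiv_eq (𝕜 := ℝ)
    rw [fderiv_clm_apply (hs.differentiableAt (by simp)) (differentiableAt_const _)] at e2
    simpa using DFunLike.congr_fun e2 C
  have hd1 : ∀ᶠ w in 𝓝 w₀, ∀ C y, fderiv ℝ (ζ 1) w C (y, 0) = 0 := by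
    filter_upwards [h1.eventually_nhds, hζ 1] with w hw hs C z
    have e1 : (fun w => ζ 1 w (z, 0)) =ᶠ[𝓝 w] fun _ => 0 := hw.mono fun _ h => h z
    have e2 := e1.fderiv_eq (𝕜 := ℝ)
    rw [fderiv_clm_apply (hs.differentiableAt (by simp)) (differentiableAt_const _)] at e2
    simpa using DFunLike.congr_fun e2 C
  have hboth : ∀ᶠ w in 𝓝 w₀, fderiv ℝ γ w (0, v₁ + β w • v₂) = 0 ∧
      fderiv ℝ β w (u₁ + γ w • u₂, 0) = 0 := by
    filter_upwards [hζ 0, hζ 1, h0, h1, hF, hu', hv', hγs, hβs, hγ0.eventually_nhds,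
      hβ0.eventually_nhds, hd0, hd1] with w a0 a1 a2 a3 a4 a5 a6 a7 a8 a9 a10 a11 a12
    have hC : ∀ α, ζ α w (u₁ + γ w • u₂, 0) = 0 := by
      intro α
      fin_cases α
      · have := a9.self_of_nhds
        rwa [← hγe] at this
      · exact a3 _
    have hB : ∀ α, ζ α w (0, v₁ + β w • v₂) = 0 := by
      intro α
      fin_cases α
      · exact a2 _
      · have := a10.self_of_nhds
        rwa [← hβe] at this
    constructor
    · refine fderiv_slope_eq_zero (a0.differentiableAt (by simp)) (a7.differentiableAt (by simp))
        a9 a5 ?_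
      -- The Frobenius condition exchanges the two arguments; the result vanishes because ζ 0 is
      -- zero on (0, z) throughout a neighbourhood.
      rw [← hγe, a4 _ _ hB hC 0, a11]
    · refine fderiv_slope_eq_zero (a1.differentiableAt (by simp)) (a8.differentiableAt (by simp))
        a10 a6 ?_
      rw [← hβe, a4 _ _ hC hB 1, a12]
  obtain ⟨y, z, ε, hε, hy0, hz0, h⟩ := exists_product_integral_surface (y₀ := w₀.1) (z₀ := w₀.2)
    hγs hβs (hboth.mono fun _ h => h.1) (hboth.mono fun _ h => h.2)
  refine ⟨γ, β, y, z, ε, hε, by rw [hy0, hz0], ?_, h⟩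
  filter_upwards [hγ0, hβ0] with w a b
  rw [hγe, hβe]
  exact ⟨a, b⟩

theorem exists_eq_smul_of_apply_eq_zero {V : Type*} [AddCommGroup V] [Module ℝ V]
    (hV : Module.finrank ℝ V = 2) {l : V →ₗ[ℝ] ℝ} (hl : l ≠ 0) {C : V} (hC : C ≠ 0) (hlC : l C = 0)
    {y : V} (hy : l y = 0) : ∃ s : ℝ, y = s • C := by
  have : FiniteDimensional ℝ V := Module.finite_of_finrank_pos (by omega)
  have h1 : Module.finrank ℝ (LinearMap.ker l) = 1 := by
    have := Module.Dual.finrank_ker_add_one_of_ne_zero (f := l) hl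
    omega
  obtain ⟨s, hs⟩ := (finrank_eq_one_iff_of_nonzero' (⟨C, hlC⟩ : LinearMap.ker l)
    (by simpa [Subtype.ext_iff] using hC)).1 h1 ⟨y, hy⟩
  exact ⟨s, (congrArg Subtype.val hs).symm⟩

end Sufficiency

/-! ### Integral surfaces of the a-distribution -/

section IntegralSurfaces

open Filter Topology Set

variable {X : Type*} [TopologicalSpace X] [ChartedSpace (EuclideanSpace ℝ (Fin 4)) X]
  [IsManifold (𝓡 4) ∞ X] {W : ThreeWeb X} {N : ℕ} {P : Type*} [TopologicalSpace P]
  [ChartedSpace (EuclideanSpace ℝ (Fin N)) P] [IsManifold (𝓡 N) ∞ P]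
  {F : AdaptedCoframes W N P}

local notation "E₂" => EuclideanSpace ℝ (Fin 2)

namespace AdaptedCoframes

/-- In a product chart the equation of Δ with index α involves only one factor, and the vanishing
obstruction makes τ zero on Δ. This gives the hypotheses of
`exists_product_integral_surface_of_forms`. -/
theorem isIntegrable_of_obstruction_eq_zero {conn : Fin 2 → Fin 2 → OneForm N P}
    {a : Fin 2 → P → ℝ} (hconn : F.IsConnection conn a) {pd qd : Fin 2 → Fin 2 → P → ℝ}
    (hpq : F.IsPfaffianDerivative conn a pd qd) {c e : Fin 2 → ℝ} (hce : ∑ i, c i * e i = 0)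
    (hker : ∀ x : Fin 2 → ℝ, ∑ i, c i * x i = 0 → ∃ s, ∀ i, x i = s * e i)
    (hc : ∑ i, c i * c i ≠ 0) (he : ∑ i, e i * e i ≠ 0)
    {ρ : P → ℝ} (ha : ∀ i p, a i p = ρ p * c i) (hρ : ∀ p, ρ p ≠ 0)
    (hobs : ∀ p, (∑ i, ∑ j, e i * e j * pd i j p = 0) ∧ (∑ i, ∑ j, e i * e j * qd i j p = 0)) :
    IsIntegrable (F.aDistribution a) := by
  intro x
  obtain ⟨p, hp⟩ := F.surjective x
  obtain ⟨w₀, G, hG0, hG⟩ := W.exists_product_chart x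
  obtain ⟨σ, -, hσ, hσG⟩ := F.exists_lift (hG.mono fun _ h => h.1) (hp.trans hG0.symm)
  set η : Fin 2 → Fin 2 → E₂ × E₂ → E₂ × E₂ →L[ℝ] ℝ :=
    fun α i => OneForm.pullback σ (F.basisForm α i) with hη
  have hηs : ∀ᶠ w in 𝓝 w₀, ∀ α i, ContDiffAt ℝ ∞ (η α i) w := by
    filter_upwards [hσ] with w hw α i
    exact OneForm.contDiffAt_pullback hw (F.smooth α i)
  have hθ : ∀ᶠ w in 𝓝 w₀, ∀ α i v,
      η α i w v = F.covector α i (σ w) (mfderiv 𝓘(ℝ, E₂ × E₂) (𝓡 4) G w v) := by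
    filter_upwards [hσ, hσG.eventually_nhds] with w h1 h2 α i v
    exact F.pullback_basisForm h1 h2 α i v
  have hη0 : ∀ᶠ w in 𝓝 w₀, ∀ i z, η 0 i w (0, z) = 0 := by
    filter_upwards [hθ, hσG, hG] with w h1 h2 h3 i z
    rw [h1]
    exact (F.mem_tangent_zero (σ w) _).1 ((W.mem_tangent_congr 0 h2.symm _).1 (h3.2.2.1 z)) i
  have hη1 : ∀ᶠ w in 𝓝 w₀, ∀ i y, η 1 i w (y, 0) = 0 := by
    filter_upwards [hθ, hσG, hG] with w h1 h2 h3 i y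
    rw [h1]
    exact (F.mem_tangent_one (σ w) _).1 ((W.mem_tangent_congr 1 h2.symm _).1 (h3.2.2.2 y)) i
  set ζ : Fin 2 → E₂ × E₂ → E₂ × E₂ →L[ℝ] ℝ := fun α w => c 0 • η α 0 w + c 1 • η α 1 w with hζ
  have hζa : ∀ α w V, ζ α w V = ∑ i, c i * η α i w V := fun α w V => by
    simp [hζ, Fin.sum_univ_two]
  have hζs : ∀ α, ∀ᶠ w in 𝓝 w₀, ContDiffAt ℝ ∞ (ζ α) w := by
    intro α
    filter_upwards [hηs] with w hw
    exact ((hw α 0).const_smul (c 0)).add ((hw α 1).const_smul (c 1))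
  have hζ0 : ∀ᶠ w in 𝓝 w₀, ∀ z, ζ 0 w (0, z) = 0 := by
    filter_upwards [hη0] with w hw z
    simp [hζa, hw]
  have hζ1 : ∀ᶠ w in 𝓝 w₀, ∀ y, ζ 1 w (y, 0) = 0 := by
    filter_upwards [hη1] with w hw y
    simp [hζa, hw]
  have hF : ∀ᶠ w in 𝓝 w₀, ∀ U V, (∀ α, ζ α w U = 0) → (∀ α, ζ α w V = 0) →
      ∀ α, fderiv ℝ (ζ α) w U V = fderiv ℝ (ζ α) w V U := by
    filter_upwards [hηs, hσ] with w h1 h2 U V hU hV α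
    have hfr : ∀ V : E₂ × E₂, (∀ α, ζ α w V = 0) → ∃ r : Fin 2 → ℝ, ∀ α i,
        F.basisForm α i (σ w) (mfderiv 𝓘(ℝ, E₂ × E₂) (𝓡 N) σ w V) = r α * e i := by
      intro V hV
      choose r hr using fun α => hker (fun i => η α i w V) (by rw [← hζa]; exact hV α)
      exact ⟨r, hr⟩
    obtain ⟨r, hr⟩ := hfr U hU
    obtain ⟨s, hs⟩ := hfr V hV
    have cU := contraction_conn_eq hconn hpq hce ha hr
    have cV := contraction_conn_eq hconn hpq hce ha hs
    rw [(hobs _).1, (hobs _).2, zero_mul, zero_mul, add_zero, neg_eq_zero] at cU cV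
    have hd := contraction_d_eq (c := c) hconn hr hs α
    rw [(mul_eq_zero.1 cU).resolve_left (hρ _), (mul_eq_zero.1 cV).resolve_left (hρ _),
      mul_zero, mul_zero, sub_zero] at hd
    simp only [← F.d_basisForm_pullback h2] at hd
    have hfd : ∀ U V, fderiv ℝ (ζ α) w U V =
        c 0 * fderiv ℝ (η α 0) w U V + c 1 * fderiv ℝ (η α 1) w U V := by
      intro U V
      have := ((((h1 α 0).differentiableAt (by simp)).hasFDerivAt.fun_const_smul (c 0)).fun_add
        (((h1 α 1).differentiableAt (by simp)).hasFDerivAt.fun_const_smul (c 1))).fderiv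
      exact DFunLike.congr_fun (DFunLike.congr_fun this U) V
    rw [Fin.sum_univ_two] at hd
    rw [hfd, hfd]
    linear_combination hd
  have hdual : ∀ r : Fin 2 → ℝ, ∃ V : E₂ × E₂, ∀ α i, η α i w₀ V = r i := by
    intro r
    obtain ⟨v, hv⟩ := F.exists_covector_eq (σ w₀) fun _ i => r i
    obtain ⟨u, hu⟩ : ∃ u : E₂ × E₂, mfderiv 𝓘(ℝ, E₂ × E₂) (𝓡 4) G w₀ u = v :=
      hG.self_of_nhds.2.1.2 v
    exact ⟨u, fun α i => (hθ.self_of_nhds α i u).trans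
      ((congrArg (F.covector α i (σ w₀)) hu).trans (hv α i))⟩
  have hsplit : ∀ V : E₂ × E₂, V = (V.1, 0) + (0, V.2) := fun V => by ext <;> simp
  have hfst : ∀ i V, η 0 i w₀ (V.1, 0) = η 0 i w₀ V := fun i V => by
    conv_rhs => rw [hsplit V, map_add, hη0.self_of_nhds, add_zero]
  have hsnd : ∀ i V, η 1 i w₀ (0, V.2) = η 1 i w₀ V := fun i V => by
    conv_rhs => rw [hsplit V, map_add, hη1.self_of_nhds, zero_add]
  -- At w₀, V₁ has components e (tangent to Δ) and V₂ components c (transversal, as c·c ≠ 0). The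
  -- line in each factor is sought in the form V₁ + gV₂.
  obtain ⟨V₁, hV₁⟩ := hdual e
  obtain ⟨V₂, hV₂⟩ := hdual c
  obtain ⟨γ, β, y, z, ε, hε, hyz0, hγβ, hyz⟩ := exists_product_integral_surface_of_forms
    (u₁ := V₁.1) (u₂ := V₂.1) (v₁ := V₁.2) (v₂ := V₂.2) hζs hζ0 hζ1 hF
    (by simpa only [hζa, hfst, hV₂] using hc) (by simpa only [hζa, hsnd, hV₂] using hc)
  have hC0 : ∀ g : ℝ, V₁.1 + g • V₂.1 ≠ 0 := by
    intro g hg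
    have h1 : ∀ i, e i + g * c i = 0 := by
      intro i
      have : η 0 i w₀ ((V₁.1, 0) + g • (V₂.1, 0)) = 0 := by
        have h0 : ((V₁.1, 0) + g • (V₂.1, 0) : E₂ × E₂) = 0 :=
          Prod.ext (by simpa using hg) (by simp)
        rw [h0, map_zero]
      rwa [map_add, map_smul, hfst, hfst, hV₁, hV₂, smul_eq_mul] at this
    apply he
    have e0 := h1 0
    have e1 := h1 1
    simp only [Fin.sum_univ_two] at hce ⊢
    -- Pairing e + gc = 0 with e leaves e·e = 0, as c·e = 0; so no slope g makes the direction
    -- degenerate.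
    linear_combination e 0 * e0 + e 1 * e1 - g * hce
  have hB0 : ∀ g : ℝ, V₁.2 + g • V₂.2 ≠ 0 := by
    intro g hg
    have h1 : ∀ i, e i + g * c i = 0 := by
      intro i
      have : η 1 i w₀ ((0, V₁.2) + g • (0, V₂.2)) = 0 := by
        have h0 : ((0, V₁.2) + g • (0, V₂.2) : E₂ × E₂) = 0 :=
          Prod.ext (by simp) (by simpa using hg)
        rw [h0, map_zero]
      rwa [map_add, map_smul, hsnd, hsnd, hV₁, hV₂, smul_eq_mul] at this
    apply he
    have e0 := h1 0
    have e1 := h1 1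
    simp only [Fin.sum_univ_two] at hce ⊢
    linear_combination e 0 * e0 + e 1 * e1 - g * hce
  have hζ0ne : ∀ᶠ w in 𝓝 w₀, ζ 0 w (V₂.1, 0) ≠ 0 :=
    ((hζs 0).self_of_nhds.continuousAt.clm_apply continuousAt_const).eventually_ne
      (by simpa only [hζa, hfst, hV₂] using hc)
  have hζ1ne : ∀ᶠ w in 𝓝 w₀, ζ 1 w (0, V₂.2) ≠ 0 :=
    ((hζs 1).self_of_nhds.continuousAt.clm_apply continuousAt_const).eventually_ne
      (by simpa only [hζa, hsnd, hV₂] using hc)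
  set Φ : E₂ → E₂ × E₂ := fun t => (y (t 0), z (t 1)) with hΦ
  have hΦ0 : Φ 0 = w₀ := hyz0
  have hΦs : ∀ t : E₂, t 0 ∈ Ioo (-ε) ε → t 1 ∈ Ioo (-ε) ε → ContDiffAt ℝ ∞ Φ t := by
    intro t h0 h1
    obtain ⟨s0, s1, -, -⟩ := hyz _ h0 _ h1
    exact (ContDiffAt.comp (g := y) (f := fun t : E₂ => t 0) t s0
      (EuclideanSpace.proj (𝕜 := ℝ) (0 : Fin 2)).contDiff.contDiffAt).prodMk
      (ContDiffAt.comp (g := z) (f := fun t : E₂ => t 1) t s1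
        (EuclideanSpace.proj (𝕜 := ℝ) (1 : Fin 2)).contDiff.contDiffAt)
  have hΦd : ∀ t : E₂, t 0 ∈ Ioo (-ε) ε → t 1 ∈ Ioo (-ε) ε → ∀ h : E₂, fderiv ℝ Φ t h =
      (h 0 • (V₁.1 + γ (Φ t) • V₂.1), h 1 • (V₁.2 + β (Φ t) • V₂.2)) := by
    intro t h0 h1 h
    obtain ⟨-, -, d0, d1⟩ := hyz _ h0 _ h1
    have := ((HasFDerivAt.comp (g := y) (f := fun t : E₂ => t 0) t d0.hasFDerivAt
      (EuclideanSpace.proj (𝕜 := ℝ) (0 : Fin 2)).hasFDerivAt).prodMk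
      (HasFDerivAt.comp (g := z) (f := fun t : E₂ => t 1) t d1.hasFDerivAt
      (EuclideanSpace.proj (𝕜 := ℝ) (1 : Fin 2)).hasFDerivAt)).fderiv
    exact DFunLike.congr_fun this h
  have hbox : ∀ᶠ t in 𝓝 (0 : E₂), t 0 ∈ Ioo (-ε) ε ∧ t 1 ∈ Ioo (-ε) ε := by
    have hI : Ioo (-ε) ε ∈ 𝓝 (0 : ℝ) := Ioo_mem_nhds (neg_neg_iff_pos.2 hε) hε
    exact ((EuclideanSpace.proj (𝕜 := ℝ) (0 : Fin 2)).continuous.tendsto (0 : E₂)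
      |>.eventually (by rw [map_zero]; exact hI)).and
      ((EuclideanSpace.proj (𝕜 := ℝ) (1 : Fin 2)).continuous.tendsto (0 : E₂)
      |>.eventually (by rw [map_zero]; exact hI))
  have hΦc : Tendsto Φ (𝓝 0) (𝓝 w₀) := by
    have := (hΦs 0 hbox.self_of_nhds.1 hbox.self_of_nhds.2).continuousAt
    rwa [ContinuousAt, hΦ0] at this
  have hgood := hbox.and (hΦc.eventually (hG.and (hσG.and (hθ.and (hζ0.and (hζ1.and
    (hγβ.and (hζ0ne.and hζ1ne))))))))
  obtain ⟨U, hUgood, hUo, h0U⟩ := eventually_nhds_iff.1 hgood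
  refine ⟨U, fun t => G (Φ t), hUo, h0U, (congrArg G hΦ0).trans hG0, ?_, ?_⟩
  · intro t ht
    obtain ⟨hb, hg, -⟩ := hUgood t ht
    exact (hg.1.comp t (hΦs t hb.1 hb.2).contMDiffAt).contMDiffWithinAt
  intro t ht
  obtain ⟨⟨hb0, hb1⟩, ⟨hGs, hGbij, -, -⟩, hproj, hθt, hz0, hz1, ⟨hC, hB⟩, hn0, hn1⟩ := hUgood t ht
  set CC := V₁.1 + γ (Φ t) • V₂.1 with hCC
  set BB := V₁.2 + β (Φ t) • V₂.2 with hBB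
  have hdφ : ∀ h : E₂, mfderiv (𝓡 2) (𝓡 4) (fun t => G (Φ t)) t h =
      mfderiv 𝓘(ℝ, E₂ × E₂) (𝓡 4) G (Φ t) (h 0 • CC, h 1 • BB) := by
    intro h
    have h1 := mfderiv_comp t (hGs.mdifferentiableAt (by simp))
      ((hΦs t hb0 hb1).contMDiffAt.mdifferentiableAt (by simp))
    rw [mfderiv_eq_fderiv] at h1
    exact (DFunLike.congr_fun h1 h).trans
      (congrArg (mfderiv 𝓘(ℝ, E₂ × E₂) (𝓡 4) G (Φ t)) (hΦd t hb0 hb1 h))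
  have hmem : ∀ V : E₂ × E₂, Membership.mem (F.aDistribution a (G (Φ t)))
      (mfderiv 𝓘(ℝ, E₂ × E₂) (𝓡 4) G (Φ t) V) ↔ ∀ α, ζ α (Φ t) V = 0 := by
    intro V
    rw [mem_aDistribution_iff hconn ha hρ hproj]
    simp only [hζa, hθt]
  have hz0' : ∀ V : E₂ × E₂, ζ 0 (Φ t) V = ζ 0 (Φ t) (V.1, 0) := fun V => by
    conv_lhs => rw [hsplit V, map_add, hz0, add_zero]
  have hz1' : ∀ V : E₂ × E₂, ζ 1 (Φ t) V = ζ 1 (Φ t) (0, V.2) := fun V => by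
    conv_lhs => rw [hsplit V, map_add, hz1, zero_add]
  have hpair0 : ∀ r : ℝ, ((r • CC, 0) : E₂ × E₂) = r • (CC, 0) := fun r => by ext <;> simp
  have hpair1 : ∀ r : ℝ, ((0, r • BB) : E₂ × E₂) = r • (0, BB) := fun r => by ext <;> simp
  constructor
  · rw [injective_iff_map_eq_zero]
    intro (h : E₂) hh
    have h2 : (h 0 • CC, h 1 • BB) = (0 : E₂ × E₂) :=
      hGbij.1 (((hdφ h).symm.trans hh).trans (map_zero _).symm)
    have h3 := (smul_eq_zero.1 (congrArg Prod.fst h2)).resolve_right (hC0 _)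
    have h4 := (smul_eq_zero.1 (congrArg Prod.snd h2)).resolve_right (hB0 _)
    exact PiLp.ext fun i => by fin_cases i <;> assumption
  · ext v
    constructor
    · rintro ⟨(h : E₂), rfl⟩
      refine (congrArg (Membership.mem (F.aDistribution a (G (Φ t)))) (hdφ h)).mpr
        ((hmem _).2 fun α => ?_)
      fin_cases α
      · change ζ 0 (Φ t) _ = 0
        rw [hz0', hpair0, map_smul, hC, smul_zero]
      · change ζ 1 (Φ t) _ = 0
        rw [hz1', hpair1, map_smul, hB, smul_zero]
    · intro hv
      obtain ⟨V, rfl⟩ : ∃ V : E₂ × E₂, mfderiv 𝓘(ℝ, E₂ × E₂) (𝓡 4) G (Φ t) V = v := hGbij.2 v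
      have hV := (hmem V).1 hv
      -- The kernel of a nonzero form on a plane is a line, so the velocity CC spans the solutions
      -- in the first factor; likewise BB in the second.
      obtain ⟨r, hr⟩ := exists_eq_smul_of_apply_eq_zero (V := E₂) (by simp)
        (l := (ζ 0 (Φ t)).toLinearMap ∘ₗ LinearMap.inl ℝ E₂ E₂) (C := CC) (y := V.1)
        (fun h => hn0 (DFunLike.congr_fun h V₂.1)) (hC0 _) hC ((hz0' V).symm.trans (hV 0))
      obtain ⟨s, hs⟩ := exists_eq_smul_of_apply_eq_zero (V := E₂) (by simp)
        (l := (ζ 1 (Φ t)).toLinearMap ∘ₗ LinearMap.inr ℝ E₂ E₂) (C := BB) (y := V.2)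
        (fun h => hn1 (DFunLike.congr_fun h V₂.2)) (hB0 _) hB ((hz1' V).symm.trans (hV 1))
      refine ⟨!₂[r, s], (hdφ _).trans (congrArg (mfderiv 𝓘(ℝ, E₂ × E₂) (𝓡 4) G (Φ t)) ?_)⟩
      exact Prod.ext (by simp [hr]) (by simp [hs])

end AdaptedCoframes

end IntegralSurfaces

namespace AdaptedCoframes

/-- If the covector of the web is proportional to the constant covector `c`, the `a`-distribution is
the plane field `c_i ω_α^i = 0`, and it is integrable if and only if the Pfaffian derivatives of
the covector vanish on the direction `e` annihilated by `c`. -/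
theorem aDistribution_eq_plane_and_isIntegrable_iff {X : Type*} [TopologicalSpace X]
    [ChartedSpace (EuclideanSpace ℝ (Fin 4)) X] [IsManifold (𝓡 4) ∞ X] {W : ThreeWeb X} {N : ℕ}
    {P : Type*} [TopologicalSpace P] [ChartedSpace (EuclideanSpace ℝ (Fin N)) P]
    [IsManifold (𝓡 N) ∞ P] {F : AdaptedCoframes W N P} {conn : Fin 2 → Fin 2 → OneForm N P}
    {a : Fin 2 → P → ℝ} (hconn : F.IsConnection conn a) {pd qd : Fin 2 → Fin 2 → P → ℝ}
    (hpq : F.IsPfaffianDerivative conn a pd qd) {c e : Fin 2 → ℝ} (hce : ∑ i, c i * e i = 0)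
    (hker : ∀ x : Fin 2 → ℝ, ∑ i, c i * x i = 0 → ∃ s, ∀ i, x i = s * e i)
    (hc : ∑ i, c i * c i ≠ 0) (he : ∑ i, e i * e i ≠ 0)
    {ρ : P → ℝ} (ha : ∀ i p, a i p = ρ p * c i) (hρ : ∀ p, ρ p ≠ 0) :
    (∀ p, F.aDistribution a (F.proj p) = F.plane p c) ∧
      (IsIntegrable (F.aDistribution a) ↔ ∀ p,
        (∑ i, ∑ j, e i * e j * pd i j p = 0) ∧ (∑ i, ∑ j, e i * e j * qd i j p = 0)) :=
  ⟨fun p => Submodule.ext fun v =>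
      (mem_aDistribution_iff hconn ha hρ rfl v).trans (F.mem_plane p c v).symm,
    obstruction_eq_zero_of_isIntegrable hconn hpq hce ha hρ,
    isIntegrable_of_obstruction_eq_zero hconn hpq hce hker hc he ha hρ⟩

end AdaptedCoframes

end

/-! ### The three special directions of the covector -/

theorem corollary2 {X : Type*} [TopologicalSpace X] [ChartedSpace (EuclideanSpace ℝ (Fin 4)) X]
    [IsManifold (𝓡 4) ∞ X] (W : ThreeWeb X)
    {N : ℕ} {P : Type*} [TopologicalSpace P] [ChartedSpace (EuclideanSpace ℝ (Fin N)) P]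
    [IsManifold (𝓡 N) ∞ P] (F : AdaptedCoframes W N P)
    (conn : Fin 2 → Fin 2 → OneForm N P) (a : Fin 2 → P → ℝ)
    (hconn : F.IsConnection conn a)
    (pd qd : Fin 2 → Fin 2 → P → ℝ) (hpq : F.IsPfaffianDerivative conn a pd qd)
    (ha : ∀ p, a 0 p ≠ 0 ∨ a 1 p ≠ 0) :
    (((∀ p, a 1 p = 0) ∧ (∀ p v, F.IsVertical p v → conn 1 0 p v = 0)) →
      (∀ p, F.aDistribution a (F.proj p) = F.plane p ![1, 0]) ∧
      (IsIntegrable (F.aDistribution a) ↔ ∀ p, pd 1 1 p = 0 ∧ qd 1 1 p = 0)) ∧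
    (((∀ p, a 0 p = 0) ∧ (∀ p v, F.IsVertical p v → conn 0 1 p v = 0)) →
      (∀ p, F.aDistribution a (F.proj p) = F.plane p ![0, 1]) ∧
      (IsIntegrable (F.aDistribution a) ↔ ∀ p, pd 0 0 p = 0 ∧ qd 0 0 p = 0)) ∧
    (((∀ p, a 0 p = a 1 p) ∧
        (∀ p v, F.IsVertical p v →
          conn 0 0 p v + conn 0 1 p v - conn 1 0 p v - conn 1 1 p v = 0)) →
      (∀ p, F.aDistribution a (F.proj p) = F.plane p ![1, 1]) ∧
      (IsIntegrable (F.aDistribution a) ↔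
        ∀ p, pd 0 0 p - 2 * ((pd 0 1 p + pd 1 0 p) / 2) + pd 1 1 p = 0 ∧
          qd 0 0 p - 2 * ((qd 0 1 p + qd 1 0 p) / 2) + qd 1 1 p = 0)) := by
  refine ⟨fun ⟨h, _⟩ => ?_, fun ⟨h, _⟩ => ?_, fun ⟨h, _⟩ => ?_⟩
  · simpa [Fin.sum_univ_two] using
      AdaptedCoframes.aDistribution_eq_plane_and_isIntegrable_iff hconn hpq (c := ![1, 0]) (e := ![0, 1])
        (ρ := a 0) (by simp [Fin.sum_univ_two])
        (fun x hx => ⟨x 1, Fin.forall_fin_two.2 ⟨by simpa [Fin.sum_univ_two] using hx, by simp⟩⟩)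
        (by simp [Fin.sum_univ_two]) (by simp [Fin.sum_univ_two])
        (Fin.forall_fin_two.2 ⟨fun p => by simp, fun p => by simp [h p]⟩)
        fun p => (ha p).resolve_right (not_not.2 (h p))
  · simpa [Fin.sum_univ_two] using
      AdaptedCoframes.aDistribution_eq_plane_and_isIntegrable_iff hconn hpq (c := ![0, 1]) (e := ![1, 0])
        (ρ := a 1) (by simp [Fin.sum_univ_two])
        (fun x hx => ⟨x 0, Fin.forall_fin_two.2 ⟨by simp, by simpa [Fin.sum_univ_two] using hx⟩⟩)
        (by simp [Fin.sum_univ_two]) (by simp [Fin.sum_univ_two])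
        (Fin.forall_fin_two.2 ⟨fun p => by simp [h p], fun p => by simp⟩)
        fun p => (ha p).resolve_left (not_not.2 (h p))
  -- Here c = (1, 1) and e = (1, -1); the quadratic form on e is the stated symmetrized combination.
  · have hsum : ∀ r : Fin 2 → Fin 2 → P → ℝ, ∀ p,
        r 0 0 p - 2 * ((r 0 1 p + r 1 0 p) / 2) + r 1 1 p =
          ∑ i, ∑ j, (![1, -1] : Fin 2 → ℝ) i * (![1, -1] : Fin 2 → ℝ) j * r i j p := by
      intro r p
      simp [Fin.sum_univ_two]
      ring
    simp only [hsum]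
    exact AdaptedCoframes.aDistribution_eq_plane_and_isIntegrable_iff hconn hpq (ρ := a 0)
      (by simp [Fin.sum_univ_two])
      (fun x hx => ⟨x 0, Fin.forall_fin_two.2 ⟨by simp, by
        simp [Fin.sum_univ_two] at hx
        simp
        linarith⟩⟩)
      (by norm_num [Fin.sum_univ_two]) (by norm_num [Fin.sum_univ_two])
      (Fin.forall_fin_two.2 ⟨fun p => by simp, fun p => by simp [h p]⟩)
      fun p h0 => (ha p).elim (fun h1 => h1 h0) fun h1 => h1 ((h p).symm.trans h0)
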